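/- **Setting.** Let $G$ be a real Lie group (for instance a closed real linear group, or a connected, simply connected real Lie group), equipped with a right-invariant metric $d_G$ that induces its topology and whose closed balls are compact. Let $\Gamma<G$ be a lattice and $Y=G/\Gamma$ with its Borel $\sigma$-algebra. Let $a\in G$ be such that $\operatorname{Ad}_a$ is diagonalizable over $\mathbb R$, and put $G^+=\{g\in G: a^kga^{-k}\to \mathrm{id}\text{ as }k\to-\infty\}$. Let $L<G$ be a closed subgroup contained in $G^+$ and normalized by $a$, with Lie algebra $\mathfrak l$ and Haar measure $m_L$; write $B^L_r$ for the open $r$-ball around the identity in $L$ with respect to $d_G$. For a $\sigma$-algebra $\mathcal A$ on $Y$ let $[y]_{\mathcal A}$ be the atom of $y$, i.e. the intersection of all members of $\mathcal A$ containing $y$, and $g\mathcal A=\{gS:S\in\mathcal A\}$ for $g\in G$. $\mathcal A$ is called *$a^{-1}$-descending* if $a\mathcal A\subseteq\mathcal A$, and *$L$-subordinate* modulo a measure $\mu$ if for $\mu$-a.e. $y$ there is $\delta>0$ with $B^L_\delta\cdot y\subset[y]_{\mathcal A}\subset B^L_{\delta^{-1}}\cdot y$. For a Borel probability measure $\mu$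 on $Y$ and sub-$\sigma$-algebras $\mathcal C,\mathcal A$ of the Borel $\sigma$-algebra with $\mathcal C$ countably generated, $H_\mu(\mathcal C|\mathcal A)=-\int_Y\log\mu_y^{\mathcal A}([y]_{\mathcal C})\,d\mu(y)\in[0,\infty]$, where $\mu_y^{\mathcal A}$ are the conditional measures. Finally, let $\tau_y^{\mathcal A}$ be the image, under $l\mapsto l\cdot y$, of $m_L$ restricted to $\{l\in L: l\cdot y\in[y]_{\mathcal A}\}$ and normalized to a probability measure; this is defined for $\mu$-a.e. $y$ when $\mu$ is an $a$-invariant probability measure and $\mathcal A$ is a countably generated sub-$\sigma$-algebra of the Borel $\sigma$-algebra that is $L$-subordinate modulo $\mu$. **Proposition (effective variational principle).** Let $\mu$ be an $a$-invariant probability measure on $Y$ (ergodic or not) and let $j\ge 0$ be an integer. Let $\mathcal A$ be a countably generated sub-$\sigma$-algebra of the Borel $\sigma$-algebra of $Y$ which is $a^{-1}$-descending and $L$-subordinate modulo $\mu$. Suppose that $K\subset Y$ is a measurable subset and $B=B^{-1}\subset L$ is a symmetric measurable subset such that $[y]_{\mathcal A}\subset B\cdot y$ for every $y\in K$. Then $$H_\mu(\mathcal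 A\,|\,a^j\mathcal A)\;\le\;\log\bigl|\det(\operatorname{Ad}_{a^j}|_{\mathfrak l})\bigr|+\int_Y\log\tau_y^{a^j\mathcal A}\bigl((Y\setminus K)\cup B\cdot\operatorname{Supp}\mu\bigr)\,d\mu(y),$$ where the last integral is taken in $[-\infty,0]$ with $\log 0=-\infty$. -/

import Mathlib

open MeasureTheory ProbabilityTheory Filter Topology Set
open scoped Manifold ContDiff ENNReal Pointwise

noncomputable section

namespace EffVar

section Entropy

variable {Y : Type*}

/-- The atom `[y]_𝒜`: the intersection of all members of `𝒜` containing `y`. -/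
def atom (𝒜 : MeasurableSpace Y) (y : Y) : Set Y := @measurableAtom Y 𝒜 y

/-- The information function `I_μ(𝒞 | 𝒜)(x) = -log μ_x^𝒜([x]_𝒞)`, with values in `[0, ∞]`;
`condExpKernel μ 𝒜 x` is the conditional measure `μ_x^𝒜`, and `-log 0 = ∞`. -/
def information (𝒞 𝒜 : MeasurableSpace Y) [MeasurableSpace Y] [StandardBorelSpace Y]
    (μ : Measure Y) [IsFiniteMeasure μ] (x : Y) : ℝ≥0∞ :=
  (-ENNReal.log (condExpKernel μ 𝒜 x (atom 𝒞 x))).toENNReal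

/-- The conditional (static) entropy `H_μ(𝒞 | 𝒜)`. -/
def condEntropy (𝒞 𝒜 : MeasurableSpace Y) [MeasurableSpace Y] [StandardBorelSpace Y]
    (μ : Measure Y) [IsFiniteMeasure μ] : ℝ≥0∞ :=
  ∫⁻ x, information 𝒞 𝒜 μ x ∂μ

/-- The integral `∫ log f dμ ∈ [-∞, 0]` of the logarithm of a function `f` with values in `[0, 1]`,
where `log 0 = -∞`. -/
def integralLog [MeasurableSpace Y] (μ : Measure Y) (f : Y → ℝ≥0∞) : EReal :=
  -((∫⁻ y, (-ENNReal.log (f y)).toENNReal ∂μ : ℝ≥0∞) : EReal)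

end Entropy

section Action

variable {G Y : Type*} [Group G] [MulAction G Y]

/-- The `σ`-algebra `g𝒜 = {g S : S ∈ 𝒜}`. -/
abbrev translate (g : G) (𝒜 : MeasurableSpace Y) : MeasurableSpace Y :=
  𝒜.comap (fun y => g⁻¹ • y)

/-- `𝒜` is `a⁻¹`-descending: `a𝒜 ⊆ 𝒜`. -/
def IsDescending (a : G) (𝒜 : MeasurableSpace Y) : Prop :=
  translate a 𝒜 ≤ 𝒜

/-- The shape in `L` of the `𝒜`-atom at `y`: the set of `l ∈ L` with `l • y ∈ [y]_𝒜`.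
For `𝒜` replaced by `a^j 𝒜` this is `a^j V a^{-j}` with `V` the shape of the `𝒜`-atom at
`a^{-j} • y`. -/
def shape (L : Subgroup G) (𝒜 : MeasurableSpace Y) (y : Y) : Set L :=
  {l | l • y ∈ atom 𝒜 y}

/-- `τ_y^𝒜`: the Haar measure of `L` restricted to the shape of the `𝒜`-atom at `y`, normalized,
and pushed forward to `Y` under the orbit map `l ↦ l • y`. -/
def tau (𝒜 : MeasurableSpace Y) [MeasurableSpace Y] (L : Subgroup G) [MeasurableSpace L]
    (mL : Measure L) (y : Y) : Measure Y :=
  (mL[|shape L 𝒜 y]).map (fun l : L => l • y)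

/-- `𝒜` is subordinate to `L` modulo `μ`: for `μ`-almost every `y` there is `δ > 0` with
`B_δ^L • y ⊆ [y]_𝒜 ⊆ B_{1/δ}^L • y`, where `B_r^L` is the open `r`-ball around the identity in `L`
for the metric of `G` restricted to `L`. -/
def IsSubordinate [MetricSpace G] (𝒜 : MeasurableSpace Y) [MeasurableSpace Y]
    (L : Subgroup G) (μ : Measure Y) : Prop :=
  ∀ᵐ y ∂μ, ∃ δ : ℝ, 0 < δ ∧
    (fun l : L => l • y) '' Metric.ball 1 δ ⊆ atom 𝒜 y ∧
    atom 𝒜 y ⊆ (fun l : L => l • y) '' Metric.ball 1 δ⁻¹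

/-- `G⁺ = {g : a^k g a^{-k} → 1 as k → -∞}`. -/
def unstable [TopologicalSpace G] (a : G) : Set G :=
  {g | Tendsto (fun k : ℤ => a ^ k * g * a ^ (-k)) atBot (𝓝 1)}

/-- There is a `G`-invariant Borel probability measure on `G ⧸ Γ`; together with discreteness of
`Γ` this says that `Γ` is a lattice. -/
def HasInvariantProbability (Γ : Subgroup G) [MeasurableSpace (G ⧸ Γ)] : Prop :=
  ∃ m : Measure (G ⧸ Γ), IsProbabilityMeasure m ∧ SMulInvariantMeasure G (G ⧸ Γ) m

end Action

section Lie

variable {E : Type*} [NormedAddCommGroup E] [NormedSpace ℝ E]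
  {G : Type*} [Group G] [TopologicalSpace G] [ChartedSpace E G]

/-- The adjoint map `Ad_g` on the tangent space at the identity: the derivative at `1` of
`x ↦ g x g⁻¹`. -/
def Ad (g : G) : GroupLieAlgebra 𝓘(ℝ, E) G →ₗ[ℝ] GroupLieAlgebra 𝓘(ℝ, E) G :=
  (mfderiv 𝓘(ℝ, E) 𝓘(ℝ, E) (fun x : G => g * x * g⁻¹) 1 : E →L[ℝ] E).toLinearMap

/-- The one-parameter subgroup `γ` of `G` has initial velocity `X`, that is, `γ t = exp (t X)`. -/
def IsOneParam (γ : ℝ → G) (X : GroupLieAlgebra 𝓘(ℝ, E) G) : Prop :=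
  (∀ s t, γ (s + t) = γ s * γ t) ∧
    HasMFDerivAt 𝓘(ℝ, ℝ) 𝓘(ℝ, E) γ 0
      (ContinuousLinearMap.toSpanSingleton ℝ (X : E) : ℝ →L[ℝ] E)

/-- The Lie algebra of a closed subgroup `L`: the vectors `X` whose one-parameter subgroup
`exp (t X)` lies in `L`. These form a linear subspace when `L` is closed; taking the span makes the
definition a subspace without an appeal to that fact. -/
def lieAlg (L : Subgroup G) : Submodule ℝ (GroupLieAlgebra 𝓘(ℝ, E) G) :=
  Submodule.span ℝ {X | ∃ γ : ℝ → G, IsOneParam γ X ∧ ∀ t, γ t ∈ L}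

/-- `Ad_g` is diagonalizable over `ℝ`. -/
def IsAdDiagonalizable (E : Type*) [NormedAddCommGroup E] [NormedSpace ℝ E]
    [ChartedSpace E G] (g : G) : Prop :=
  ⨆ t : ℝ, Module.End.eigenspace (Ad (E := E) g) t = ⊤

theorem Ad_mem_lieAlg [LieGroup 𝓘(ℝ, E) ∞ G] {L : Subgroup G} {g : G}
    (hg : g ∈ Subgroup.normalizer (L : Set G)) :
    ∀ X ∈ lieAlg (E := E) L, Ad g X ∈ lieAlg (E := E) L := by
  intro X hX
  have hmap : (lieAlg (E := E) L).map (Ad g) ≤ lieAlg (E := E) L := by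
    rw [lieAlg, Submodule.map_span, Submodule.span_le]
    rintro _ ⟨X, ⟨γ, ⟨hγ, hd⟩, hL⟩, rfl⟩
    refine Submodule.subset_span ⟨fun t => g * γ t * g⁻¹, ⟨fun s t => ?_, ?_⟩, fun t => ?_⟩
    · simp [hγ, mul_assoc]
    · have h0 : γ 0 = 1 := by simpa using hγ 0 0
      have hc : MDifferentiableAt 𝓘(ℝ, E) 𝓘(ℝ, E) (fun x : G => g * x * g⁻¹) (γ 0) := by
        have h1 : ContMDiff 𝓘(ℝ, E) 𝓘(ℝ, E) ∞ (fun x : G => g * x * g⁻¹) :=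
          (contMDiff_mul_right (a := g⁻¹)).comp (contMDiff_mul_left (a := g))
        exact (h1 (γ 0)).mdifferentiableAt (by simp)
      have h2 := hc.hasMFDerivAt.comp (0 : ℝ) hd
      rw [h0] at h2
      have h3 : (mfderiv 𝓘(ℝ, E) 𝓘(ℝ, E) (fun x : G => g * x * g⁻¹) 1 : E →L[ℝ] E).comp
          (ContinuousLinearMap.toSpanSingleton ℝ (X : E) : ℝ →L[ℝ] E) =
          ContinuousLinearMap.toSpanSingleton ℝ (Ad g X : E) := by
        ext
        exact map_smul (mfderiv 𝓘(ℝ, E) 𝓘(ℝ, E) (fun x : G => g * x * g⁻¹) 1 : E →L[ℝ] E) (1 : ℝ) X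
      exact h3 ▸ h2
    · exact (Subgroup.mem_normalizer_iff.1 hg (γ t)).1 (hL t)
  exact hmap ⟨X, hX, rfl⟩

/-- `det (Ad_g restricted to the Lie algebra of L)`, for `g` normalizing `L`. -/
def detAd (E : Type*) [NormedAddCommGroup E] [NormedSpace ℝ E] [ChartedSpace E G]
    [LieGroup 𝓘(ℝ, E) ∞ G] (L : Subgroup G) (g : G)
    (hg : g ∈ Subgroup.normalizer (L : Set G)) : ℝ :=
  LinearMap.det ((Ad (E := E) g).restrict (Ad_mem_lieAlg hg))

end Lie

/-- A second countable, `σ`-compact, metrizable space with its Borel `σ`-algebra is standard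
Borel. -/
theorem standardBorelSpace_of_sigmaCompact {Y : Type*} [TopologicalSpace Y]
    [SecondCountableTopology Y] [SigmaCompactSpace Y] [TopologicalSpace.MetrizableSpace Y]
    [MeasurableSpace Y] [BorelSpace Y] : StandardBorelSpace Y := by
  let := TopologicalSpace.metrizableSpaceMetric Y
  let : MeasurableSpace (UniformSpace.Completion Y) := borel _
  have : BorelSpace (UniformSpace.Completion Y) := ⟨rfl⟩
  have hemb : IsEmbedding ((↑) : Y → UniformSpace.Completion Y) :=
    UniformSpace.Completion.isUniformEmbedding_coe Y |>.isEmbedding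
  have hr : MeasurableSet (range ((↑) : Y → UniformSpace.Completion Y)) := by
    rw [← image_univ, ← iUnion_compactCovering, image_iUnion]
    exact MeasurableSet.iUnion fun n =>
      ((isCompact_compactCovering Y n).image hemb.continuous).measurableSet
  have hme : MeasurableEmbedding ((↑) : Y → UniformSpace.Completion Y) :=
    hemb.measurableEmbedding hr
  have : StandardBorelSpace (range ((↑) : Y → UniformSpace.Completion Y)) := hr.standardBorel
  let e := hme.equivRange
  obtain ⟨t, ht, hp⟩ := this
  refine ⟨t.induced e, ?_, ?_⟩
  · refine @BorelSpace.mk _ (_) _ ?_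
    refine e.measurableEmbedding.comap_eq.symm.trans ?_
    refine (congrArg (MeasurableSpace.comap e) ht.measurable_eq).trans ?_
    exact (borel_comap (t := t) (f := e)).symm
  · exact e.toEquiv.polishSpace_induced

instance standardBorelSpace_quotient {G : Type*} [Group G] [MetricSpace G] [ProperSpace G]
    [IsTopologicalGroup G] (Γ : Subgroup G) [DiscreteTopology Γ] [MeasurableSpace (G ⧸ Γ)]
    [BorelSpace (G ⧸ Γ)] : StandardBorelSpace (G ⧸ Γ) := by
  have : SigmaCompactSpace (G ⧸ Γ) := by
    refine ⟨fun n => ((↑) : G → G ⧸ Γ) '' compactCovering G n, fun n =>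
      (isCompact_compactCovering G n).image QuotientGroup.continuous_mk, ?_⟩
    rw [← image_iUnion, iUnion_compactCovering, image_univ]
    exact range_eq_univ.2 QuotientGroup.mk_surjective
  exact standardBorelSpace_of_sigmaCompact

end EffVar

end

/-! Let `κ_y` be the conditional measures of `μ` given `a^j 𝒜` and `τ_y` the normalized Haar
measures on the atoms of `a^j 𝒜`. Up to null sets both depend only on the `a^j 𝒜`-atom, which splits
into `𝒜`-atoms. Jensen's inequality on each `a^j 𝒜`-atom, relative to an `𝒜`-saturated set `D` of
full measure, gives `∫ -log κ_y([y]_𝒜) + ∫ -log τ_y(D) ≤ ∫ -log τ_y([y]_𝒜)`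
(`lintegral_negLog_add_le`).

The right side is a volume computation. `τ_y([y]_𝒜)` is a quotient of Haar volumes of two shapes,
and conjugation by `a^j` turns `-log` of it into the log of the modulus of that conjugation plus a
coboundary, which contributes nothing positive (`lintegral_negLog_tau_atom_le`). The volumes are
finite because Poincaré recurrence makes almost all stabilizers in `G⁺` trivial
(`ae_unstable_smul_ne`).

`D` consists of the points whose `𝒜`-atom has positive `κ`-mass and whose `κ` is carried by `Supp
μ`. The atom of such a point then meets `Supp μ`; over `K` the atom lies in `B • y`, so `y ∈ B •
Supp μ` by symmetry of `B`.

It remains to bound the modulus by `|det Ad|` (`mulEquivHaarChar_conjEquiv_le`). A chart of `G`,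
projected to the Lie algebra of `L`, is a first-order model of `L` near the identity; this is
Cartan's closed subgroup argument. In such a model Haar measure is compared with Lebesgue measure on
small balls, and conjugation is to first order the adjoint map. -/

namespace EffVar

/-! ### The pointwise inequality behind Jensen -/

/-- The function `-log : [0, ∞] → [0, ∞]`, truncated at `0`. -/
noncomputable def negLog (x : ℝ≥0∞) : ℝ≥0∞ := (-ENNReal.log x).toENNReal

theorem measurable_negLog : Measurable negLog :=
  measurable_ereal_toENNReal.comp (ENNReal.measurable_log.neg)

theorem negLog_anti : Antitone negLog := fun _ _ h =>
  EReal.toENNReal_le_toENNReal (EReal.neg_le_neg_iff.2 (ENNReal.log_le_log h))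

theorem negLog_eq_ofReal {x : ℝ≥0∞} (h0 : x ≠ 0) (h1 : x ≠ ⊤) :
    negLog x = ENNReal.ofReal (-Real.log x.toReal) := by
  rw [negLog, ENNReal.log_pos_real h0 h1, ← EReal.coe_neg, EReal.real_coe_toENNReal]

/-- This is `log u ≤ u - 1` at `u = t / (x y)`. The form without subtraction can be integrated even
when the logarithms are not integrable. -/
theorem negLog_add_negLog_add_one_le {x y t : ℝ≥0∞} (hx : x ≠ 0) (hx1 : x ≤ 1) (hy : y ≠ 0)
    (hy1 : y ≤ 1) (ht : t ≠ 0) (ht1 : t ≤ 1) :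
    negLog x + negLog y + 1 ≤ negLog t + t * x⁻¹ * y⁻¹ := by
  have hxt : x ≠ ⊤ := ne_top_of_le_ne_top ENNReal.one_ne_top hx1
  have hyt : y ≠ ⊤ := ne_top_of_le_ne_top ENNReal.one_ne_top hy1
  have htt : t ≠ ⊤ := ne_top_of_le_ne_top ENNReal.one_ne_top ht1
  have px := ENNReal.toReal_pos hx hxt
  have py := ENNReal.toReal_pos hy hyt
  have pt := ENNReal.toReal_pos ht htt
  have nl : ∀ {s : ℝ≥0∞}, s ≤ 1 → s ≠ 0 → 0 ≤ -Real.log s.toReal := fun {s} hs h0 => by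
    have : s.toReal ≤ 1 := by simpa using ENNReal.toReal_mono ENNReal.one_ne_top hs
    linarith [Real.log_nonpos ENNReal.toReal_nonneg this]
  rw [negLog_eq_ofReal hx hxt, negLog_eq_ofReal hy hyt, negLog_eq_ofReal ht htt]
  have e : t * x⁻¹ * y⁻¹ = ENNReal.ofReal (t.toReal * x.toReal⁻¹ * y.toReal⁻¹) := by
    rw [ENNReal.ofReal_mul (by positivity), ENNReal.ofReal_mul (by positivity),
      ENNReal.ofReal_inv_of_pos px, ENNReal.ofReal_inv_of_pos py, ENNReal.ofReal_toReal hxt,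
      ENNReal.ofReal_toReal hyt, ENNReal.ofReal_toReal htt]
  rw [e, ← ENNReal.ofReal_one, ← ENNReal.ofReal_add (nl hx1 hx) (nl hy1 hy),
    ← ENNReal.ofReal_add (add_nonneg (nl hx1 hx) (nl hy1 hy)) zero_le_one,
    ← ENNReal.ofReal_add (nl ht1 ht) (by positivity)]
  apply ENNReal.ofReal_le_ofReal
  have := Real.log_le_sub_one_of_pos (x := t.toReal * x.toReal⁻¹ * y.toReal⁻¹) (by positivity)
  rw [Real.log_mul (by positivity) (by positivity), Real.log_mul (by positivity) (by positivity),
    Real.log_inv, Real.log_inv] at this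
  linarith

/-! ### Gibbs' inequality along a nested pair of partitions -/

section Fibers

variable {Y Z : Type*} [MeasurableSpace Y] [MeasurableSpace Z] [MeasurableEq Z]
  {p q : Y → Z}

theorem measurableSet_fiber (hp : Measurable p) :
    MeasurableSet {x : Y × Y | p x.2 = p x.1} :=
  measurableSet_eq_fun (hp.comp measurable_snd) (hp.comp measurable_fst)

theorem measurableSet_fiber_at (hp : Measurable p) (y : Y) : MeasurableSet {z | p z = p y} :=
  measurable_prodMk_left (measurableSet_fiber hp)

theorem measurable_measure_fiber (hp : Measurable p) (ν : Measure Y) [SFinite ν] :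
    Measurable fun y => ν {z | p z = p y} :=
  measurable_measure_prodMk_left (measurableSet_fiber hp)

/-- Integrating over `τ` the fibers of `p` against a weight that is constant on fibers. -/
theorem lintegral_fiber_comm (hp : Measurable p) (ν τ : Measure Y) [SFinite ν] [SFinite τ]
    {h : Y → ℝ≥0∞} (hm : Measurable h) (hh : ∀ y z, p z = p y → h z = h y) :
    ∫⁻ z, h z * τ {w | p w = p z} ∂ν = ∫⁻ w, h w * ν {z | p z = p w} ∂τ := by
  have hE := measurableSet_fiber hp
  have h1 : ∀ z, h z * τ {w | p w = p z} =
      ∫⁻ w, h z * {x : Y × Y | p x.2 = p x.1}.indicator 1 (z, w) ∂τ := fun z => by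
    rw [← lintegral_indicator_one (measurableSet_fiber_at hp z), ← lintegral_const_mul _
      (measurable_one.indicator (measurableSet_fiber_at hp z))]
    rfl
  have h2 : ∀ w, h w * ν {z | p z = p w} =
      ∫⁻ z, h z * {x : Y × Y | p x.2 = p x.1}.indicator 1 (z, w) ∂ν := fun w => by
    rw [← lintegral_indicator_one (measurableSet_fiber_at hp w), ← lintegral_const_mul _
      (measurable_one.indicator (measurableSet_fiber_at hp w))]
    refine lintegral_congr fun z => ?_
    by_cases hz : p z = p w
    · have hz' : p w = p z := hz.symm
      simp [indicator, hz, hh w z hz]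
    · have hz' : ¬ p w = p z := fun h => hz h.symm
      simp [indicator, hz, hz']
  simp_rw [h1, h2]
  exact lintegral_lintegral_swap
    (((hm.comp measurable_fst).mul (measurable_one.indicator hE)).aemeasurable)

/-- Fubini on the relation `p z = p w`, restricted to the union `N` of the `ν`-null fibers, gives
`∫_N τ(fiber) dν = 0`. Hence `N` is `ν`-null as soon as `τ` charges almost every fiber. -/
theorem ae_measure_fiber_ne_zero (hp : Measurable p) (ν τ : Measure Y) [SFinite ν] [SFinite τ]
    (h : ∀ᵐ z ∂ν, τ {w | p w = p z} ≠ 0) : ∀ᵐ z ∂ν, ν {w | p w = p z} ≠ 0 := by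
  have hN : MeasurableSet {z | ν {w | p w = p z} = 0} :=
    measurable_measure_fiber hp ν (measurableSet_singleton 0)
  have key := lintegral_fiber_comm hp ν τ (h := {z | ν {w | p w = p z} = 0}.indicator 1)
    (measurable_one.indicator hN) (fun y z hyz => by simp [indicator, hyz])
  have hr : ∫⁻ w, {z | ν {w | p w = p z} = 0}.indicator 1 w * ν {z | p z = p w} ∂τ = 0 := by
    rw [← lintegral_zero (μ := τ)]
    refine lintegral_congr fun w => ?_
    by_cases hw : ν {z | p z = p w} = 0 <;> simp [indicator, hw]
  rw [hr] at key
  replace key := (lintegral_eq_zero_iff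
    ((measurable_one.indicator hN).mul (measurable_measure_fiber hp τ))).1 key
  filter_upwards [key, h] with z hz hz' h0
  simp [indicator, h0] at hz
  exact hz' hz

/-- With density `1 / ν(fiber)` each fiber gets `ν`-mass at most one, so after Fubini at most the
`τ`-mass of `D` is left. -/
theorem lintegral_fiber_div_le (hp : Measurable p) (ν τ : Measure Y) [SFinite ν] [SFinite τ]
    {D : Set Y} (hD : MeasurableSet D) (hsat : ∀ y z, p z = p y → (z ∈ D ↔ y ∈ D)) :
    ∫⁻ z in D, τ {w | p w = p z} * (ν {w | p w = p z})⁻¹ ∂ν ≤ τ D := by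
  have key := lintegral_fiber_comm hp ν τ (h := D.indicator fun z => (ν {w | p w = p z})⁻¹)
    ((measurable_measure_fiber hp ν).inv.indicator hD)
    (fun y z hyz => by by_cases hy : y ∈ D <;> simp [hy, hsat y z hyz, hyz])
  calc ∫⁻ z in D, τ {w | p w = p z} * (ν {w | p w = p z})⁻¹ ∂ν
      = ∫⁻ z, D.indicator (fun z => (ν {w | p w = p z})⁻¹) z * τ {w | p w = p z} ∂ν := by
        rw [← lintegral_indicator hD]
        refine lintegral_congr fun z => ?_
        by_cases hz : z ∈ D <;> simp [hz, mul_comm]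
    _ = _ := key
    _ ≤ ∫⁻ w, D.indicator 1 w ∂τ := by
        refine lintegral_mono fun w => ?_
        by_cases hw : w ∈ D
        · simp [hw]
        · simp [hw]
    _ = τ D := lintegral_indicator_one hD

variable {μ : Measure Y} {κ τ : Kernel Y Y} [IsMarkovKernel κ]
  [IsFiniteKernel τ]

theorem measurable_kernel_fiber (hp : Measurable p) (η : Kernel Y Y) [IsFiniteKernel η] :
    Measurable fun y => η y {z | p z = p y} :=
  Kernel.measurable_kernel_prodMk_left (measurableSet_fiber hp)

/-- Conditional measures may vanish on every finer atom; the positivity of `τ` excludes this. On a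
single `q`-fiber both kernels are constant, so `ae_measure_fiber_ne_zero` applies to `κ y` and `τ
y`. -/
theorem ae_kernel_fiber_ne_zero (hp : Measurable p) (hκμ : κ ∘ₘ μ = μ)
    (hκ : ∀ y z, q z = q y → κ z = κ y) (hκq : ∀ᵐ y ∂μ, ∀ᵐ z ∂κ y, q z = q y)
    (hτ : ∀ᵐ y ∂μ, ∀ z, q z = q y → τ z = τ y)
    (hpos : ∀ᵐ y ∂μ, τ y {z | p z = p y} ≠ 0) :
    ∀ᵐ y ∂μ, κ y {z | p z = p y} ≠ 0 := by
  have hpos' : ∀ᵐ y ∂μ, ∀ᵐ z ∂κ y, τ z {w | p w = p z} ≠ 0 :=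
    Measure.ae_ae_of_ae_comp (by rwa [hκμ])
  rw [← hκμ]
  refine Measure.ae_comp_of_ae_ae
    (measurable_kernel_fiber hp κ (measurableSet_singleton 0)).compl ?_
  filter_upwards [hpos', hκq, hτ] with y h1 h2 h3
  have h4 : ∀ᵐ z ∂κ y, τ y {w | p w = p z} ≠ 0 := by
    filter_upwards [h1, h2] with z hz hqz
    rwa [← h3 z hqz]
  filter_upwards [ae_measure_fiber_ne_zero hp (κ y) (τ y) h4, h2] with z hz hqz
  rwa [hκ y z hqz]

/-- Jensen inequality for the conditional information function: the entropy of the fibers of `p`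
with respect to `κ`, compared with the reference measures `τ`. -/
theorem lintegral_negLog_add_le [IsProbabilityMeasure μ] (hp : Measurable p) (hκμ : κ ∘ₘ μ = μ)
    (hκ : ∀ y z, q z = q y → κ z = κ y) (hκq : ∀ᵐ y ∂μ, ∀ᵐ z ∂κ y, q z = q y)
    (hτ : ∀ᵐ y ∂μ, ∀ z, q z = q y → τ z = τ y) (hτ1 : ∀ y, τ y univ ≤ 1)
    (hpos : ∀ᵐ y ∂μ, τ y {z | p z = p y} ≠ 0)
    {D : Set Y} (hD : MeasurableSet D) (hsat : ∀ y z, p z = p y → (z ∈ D ↔ y ∈ D))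
    (hDμ : ∀ᵐ y ∂μ, y ∈ D) :
    ∫⁻ y, negLog (κ y {z | p z = p y}) ∂μ + ∫⁻ y, negLog (τ y D) ∂μ ≤
      ∫⁻ y, negLog (τ y {z | p z = p y}) ∂μ := by
  have mκ := measurable_kernel_fiber hp κ
  have mτ := measurable_kernel_fiber hp τ
  have mD := τ.measurable_coe hD
  have mR : Measurable fun y => τ y {z | p z = p y} * (κ y {z | p z = p y})⁻¹ * (τ y D)⁻¹ :=
    (mτ.mul mκ.inv).mul mD.inv
  -- After disintegrating `μ` over `κ`, the inner integral on one `q`-fiber is at most `τ y D * (τ y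
  -- D)⁻¹`.
  have hR : ∫⁻ y, τ y {z | p z = p y} * (κ y {z | p z = p y})⁻¹ * (τ y D)⁻¹ ∂μ ≤ 1 := by
    conv_lhs => rw [← hκμ]
    rw [Measure.lintegral_bind κ.aemeasurable mR.aemeasurable]
    calc _ ≤ ∫⁻ _, 1 ∂μ := by
          refine lintegral_mono_ae ?_
          have hD' : ∀ᵐ y ∂μ, ∀ᵐ z ∂κ y, z ∈ D := Measure.ae_ae_of_ae_comp (by rwa [hκμ])
          filter_upwards [hκq, hτ, hD'] with y h2 h3 h4
          calc ∫⁻ z, τ z {w | p w = p z} * (κ z {w | p w = p z})⁻¹ * (τ z D)⁻¹ ∂κ y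
              = ∫⁻ z, (τ y {w | p w = p z} * (κ y {w | p w = p z})⁻¹) * (τ y D)⁻¹ ∂κ y := by
                refine lintegral_congr_ae ?_
                filter_upwards [h2] with z hz
                rw [h3 z hz, hκ y z hz]
            _ = (∫⁻ z, τ y {w | p w = p z} * (κ y {w | p w = p z})⁻¹ ∂κ y) * (τ y D)⁻¹ :=
                lintegral_mul_const _ ((measurable_measure_fiber hp (τ y)).mul
                  (measurable_measure_fiber hp (κ y)).inv)
            _ ≤ τ y D * (τ y D)⁻¹ := by
                gcongr
                have := lintegral_fiber_div_le hp (κ y) (τ y) hD hsat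
                rwa [Measure.restrict_eq_self_of_ae_mem h4] at this
            _ ≤ 1 := ENNReal.mul_inv_le_one _
      _ = 1 := by simp
  have hmain : ∫⁻ y, (negLog (κ y {z | p z = p y}) + negLog (τ y D) + 1) ∂μ ≤
      ∫⁻ y, (negLog (τ y {z | p z = p y}) +
        τ y {z | p z = p y} * (κ y {z | p z = p y})⁻¹ * (τ y D)⁻¹) ∂μ := by
    refine lintegral_mono_ae ?_
    filter_upwards [ae_kernel_fiber_ne_zero hp hκμ hκ hκq hτ hpos, hpos, hDμ] with y h1 h2 h3
    refine negLog_add_negLog_add_one_le h1 prob_le_one ?_ ((measure_mono (subset_univ _)).trans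
      (hτ1 y)) h2 ((measure_mono (subset_univ _)).trans (hτ1 y))
    -- `D` is saturated, so it contains the fiber of `y`, which `τ y` charges.
    refine fun h0 => h2 (measure_mono_null (fun z hz => ?_) h0)
    exact (hsat y z hz).2 h3
  rw [lintegral_add_right _ measurable_const,
    lintegral_add_left (show Measurable fun y => negLog (κ y {z | p z = p y}) from
      measurable_negLog.comp mκ),
    lintegral_add_left (show Measurable fun y => negLog (τ y {z | p z = p y}) from
      measurable_negLog.comp mτ)] at hmain
  simp only [lintegral_const, measure_univ, mul_one] at hmain
  -- The `+ 1` on the left absorbs the integral of the quotient, which is at most one.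
  exact (ENNReal.add_le_add_iff_right ENNReal.one_ne_top).1 (hmain.trans (by gcongr))

end Fibers

/-! ### Atoms and conditional measures of countably generated σ-algebras -/

section SigmaAlgebras

variable {Y : Type*}

/-- A map to the Cantor space whose fibers are the atoms of a countably generated `σ`-algebra. -/
noncomputable def atomMap (𝒜 : MeasurableSpace Y)
    (h : @MeasurableSpace.CountablyGenerated Y 𝒜) : Y → ℕ → Bool :=
  @MeasurableSpace.mapNatBool Y 𝒜 h

theorem measurable_atomMap (𝒜 : MeasurableSpace Y)
    (h : @MeasurableSpace.CountablyGenerated Y 𝒜) : Measurable[𝒜] (atomMap 𝒜 h) :=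
  @MeasurableSpace.measurable_mapNatBool Y 𝒜 h

theorem mem_atom_iff {𝒜 : MeasurableSpace Y} (h : @MeasurableSpace.CountablyGenerated Y 𝒜)
    {y z : Y} : z ∈ atom 𝒜 y ↔ atomMap 𝒜 h z = atomMap 𝒜 h y := by
  constructor
  · intro hz
    exact @mem_of_mem_measurableAtom Y 𝒜 y z hz {w | atomMap 𝒜 h w = atomMap 𝒜 h y}
      (measurable_atomMap 𝒜 h (measurableSet_singleton _)) rfl
  · intro hzy
    -- Points with the same code are not separated by the generators, hence by no member of the
    -- σ-algebra.
    have key : ∀ s, MeasurableSet[𝒜] s → (z ∈ s ↔ y ∈ s) := by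
      intro s hs
      rw [← @MeasurableSpace.generateFrom_natGeneratingSequence Y 𝒜 h] at hs
      induction s, hs using MeasurableSpace.generateFrom_induction with
      | hC t ht _ =>
        obtain ⟨n, rfl⟩ := ht
        have := congrFun hzy n
        simpa [atomMap, MeasurableSpace.mapNatBool] using this
      | empty => simp
      | compl t _ ih => simp [ih]
      | iUnion f _ ih => simp [ih]
    simp only [atom, measurableAtom, mem_iInter]
    exact fun s hys hs => (key s hs).2 hys

theorem atom_eq_fiber {𝒜 : MeasurableSpace Y} (h : @MeasurableSpace.CountablyGenerated Y 𝒜)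
    (y : Y) : atom 𝒜 y = {z | atomMap 𝒜 h z = atomMap 𝒜 h y} :=
  Set.ext fun _ => mem_atom_iff h

theorem atom_anti {𝒞 𝒜 : MeasurableSpace Y} (h : 𝒞 ≤ 𝒜) (y : Y) : atom 𝒜 y ⊆ atom 𝒞 y := by
  intro z hz
  simp only [atom, measurableAtom, mem_iInter] at hz ⊢
  exact fun s hy hs => hz s hy (h s hs)

variable {𝒞 : MeasurableSpace Y} [ℬ : MeasurableSpace Y] [StandardBorelSpace Y]

/-- The conditional measures of `μ` with respect to `𝒞`, as a kernel for the Borel `σ`-algebra. -/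
noncomputable def condKernel (μ : Measure Y) [IsFiniteMeasure μ]
    (h𝒞 : 𝒞 ≤ ℬ) : Kernel Y Y :=
  @Kernel.comap Y Y 𝒞 ℬ Y ℬ (condExpKernel μ 𝒞) id (measurable_id'' h𝒞)

variable {μ : Measure Y} [IsFiniteMeasure μ] (h𝒞 : 𝒞 ≤ ℬ)

instance : IsMarkovKernel (condKernel μ h𝒞) := by
  unfold condKernel; infer_instance

theorem condKernel_comp : condKernel μ h𝒞 ∘ₘ μ = μ := by
  conv_rhs => rw [← condExpKernel_comp_trim h𝒞 (μ := μ)]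
  ext s hs
  rw [Measure.bind_apply hs (Kernel.aemeasurable _),
    @Measure.bind_apply Y Y 𝒞 ℬ _ _ s hs (@Kernel.aemeasurable _ _ 𝒞 ℬ _ _),
    lintegral_trim h𝒞 (measurable_condExpKernel hs)]
  rfl

theorem condKernel_congr (hgen : @MeasurableSpace.CountablyGenerated Y 𝒞) (y z : Y)
    (h : atomMap 𝒞 hgen z = atomMap 𝒞 hgen y) : condKernel μ h𝒞 z = condKernel μ h𝒞 y :=
  @Kernel.apply_congr_of_mem_measurableAtom Y Y 𝒞 ℬ (condExpKernel μ 𝒞) z y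
    ((mem_atom_iff hgen).2 h)

/-- The conditional measures disintegrate the image of `μ` on the diagonal, as a measure for `𝒞 ⊗
ℬ`. Lying in the same atom is a `𝒞 ⊗ ℬ`-measurable relation containing the diagonal. -/
theorem ae_condKernel_atomMap_eq (hgen : @MeasurableSpace.CountablyGenerated Y 𝒞) :
    ∀ᵐ y ∂μ, ∀ᵐ z ∂condKernel μ h𝒞 y, atomMap 𝒞 hgen z = atomMap 𝒞 hgen y := by
  have hq := measurable_atomMap 𝒞 hgen
  have h1 : @Measurable (Y × Y) (ℕ → Bool) (𝒞.prod ℬ) _ fun x => atomMap 𝒞 hgen x.2 :=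
    (hq.mono h𝒞 le_rfl).comp (@measurable_snd Y Y 𝒞 ℬ)
  have h2 : @Measurable (Y × Y) (ℕ → Bool) (𝒞.prod ℬ) _ fun x => atomMap 𝒞 hgen x.1 :=
    hq.comp (@measurable_fst Y Y 𝒞 ℬ)
  have hE : MeasurableSet[𝒞.prod ℬ] {x : Y × Y | atomMap 𝒞 hgen x.2 = atomMap 𝒞 hgen x.1} :=
    @measurableSet_eq_fun _ _ (𝒞.prod ℬ) _ _ _ _ h1 h2
  have hd : @Measurable Y (Y × Y) ℬ (𝒞.prod ℬ) Function.diag :=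
    @Measurable.prodMk Y ℬ Y Y 𝒞 ℬ id id (measurable_id'' h𝒞) measurable_id
  have hae : ∀ᵐ x ∂(@Measure.map Y (Y × Y) ℬ (𝒞.prod ℬ) Function.diag μ),
      atomMap 𝒞 hgen x.2 = atomMap 𝒞 hgen x.1 := by
    rw [@ae_map_iff _ _ ℬ (𝒞.prod ℬ) _ _
      (@Measurable.aemeasurable _ _ ℬ (𝒞.prod ℬ) _ _ hd) _ hE]
    exact Eventually.of_forall fun y => rfl
  rw [← compProd_trim_condExpKernel h𝒞] at hae
  exact ae_of_ae_trim h𝒞 (Measure.ae_ae_of_ae_compProd hae)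

end SigmaAlgebras

/-! ### Coboundaries of possibly non-integrable functions -/

section Coboundary

variable {Y : Type*} [MeasurableSpace Y] {μ : Measure Y} [IsProbabilityMeasure μ]

/-- If a coboundary `w ∘ T - w` is bounded below by the constant `-c`, then `c ≥ 0` and the
coboundary has nonpositive integral. -/
theorem lintegral_coboundary_add_le {T : Y → Y} (hT : MeasurePreserving T μ μ) {w : Y → ℝ}
    (hw : Measurable w) {c : ℝ} (h : ∀ᵐ y ∂μ, 0 ≤ w (T y) - w y + c) :
    0 ≤ c ∧ ∫⁻ y, ENNReal.ofReal (w (T y) - w y + c) ∂μ ≤ ENNReal.ofReal c := by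
  have key : ∀ c : ℝ, 0 ≤ c → (∀ᵐ y ∂μ, 0 ≤ w (T y) - w y + c) →
      ∫⁻ y, ENNReal.ofReal (w (T y) - w y + c) ∂μ ≤ ENNReal.ofReal c := by
    intro c hc h
    -- Truncation to `[-n, n]` makes `w` integrable. It is monotone and 1-Lipschitz, so for `c ≥ 0`
    -- the lower bound `-c` on the coboundary survives; invariance then gives the integral exactly
    -- `c`, and Fatou passes to the limit.
    let k : ℕ → Y → ℝ := fun n y => max (-(n : ℝ)) (min (n : ℝ) (w y))
    have hk : ∀ n, Measurable (k n) := fun n => measurable_const.max (measurable_const.min hw)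
    have hkb : ∀ n y, ‖k n y‖ ≤ n := fun n y => by
      rw [Real.norm_eq_abs, abs_le]
      have : (0 : ℝ) ≤ n := n.cast_nonneg
      exact ⟨le_max_left _ _, max_le (by linarith) (min_le_left _ _)⟩
    have hki : ∀ n, Integrable (k n) μ := fun n =>
      Integrable.of_bound (hk n).aestronglyMeasurable n (Eventually.of_forall (hkb n))
    have hkT : ∀ n, Integrable (fun y => k n (T y)) μ := fun n =>
      hT.integrable_comp_of_integrable (hki n)
    have hn : ∀ n, ∫⁻ y, ENNReal.ofReal (k n (T y) - k n y + c) ∂μ = ENNReal.ofReal c := by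
      intro n
      rw [← ofReal_integral_eq_lintegral_ofReal]
      · congr 1
        rw [integral_add (f := fun y => k n (T y) - k n y) ((hkT n).sub (hki n))
          (integrable_const c), integral_sub (hkT n) (hki n)]
        have : ∫ y, k n (T y) ∂μ = ∫ y, k n y ∂μ := by
          rw [← integral_map hT.aemeasurable (by
            rw [hT.map_eq]; exact (hki n).aestronglyMeasurable), hT.map_eq]
        simp [this]
      · exact ((hkT n).sub (hki n)).add (integrable_const c)
      · filter_upwards [h] with y hy
        have h1 : w y - c ≤ w (T y) := by linarith
        simp only [k, Pi.zero_apply]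
        have hn0 : (0 : ℝ) ≤ n := n.cast_nonneg
        rcases max_cases (-(n : ℝ)) (min (n : ℝ) (w y)) with h2 | h2 <;>
        rcases max_cases (-(n : ℝ)) (min (n : ℝ) (w (T y))) with h3 | h3 <;>
        rcases min_cases (n : ℝ) (w y) with h4 | h4 <;>
        rcases min_cases (n : ℝ) (w (T y)) with h5 | h5 <;> linarith
    have hlim : ∀ y, Tendsto (fun n => ENNReal.ofReal (k n (T y) - k n y + c)) atTop
        (𝓝 (ENNReal.ofReal (w (T y) - w y + c))) := by
      have hev : ∀ y, ∀ᶠ n : ℕ in atTop, k n y = w y := fun y => by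
        filter_upwards [eventually_ge_atTop ⌈|w y|⌉₊] with n hn
        have h1 : |w y| ≤ n := (Nat.le_ceil _).trans (by exact_mod_cast hn)
        rw [abs_le] at h1
        simp only [k]
        rw [min_eq_right h1.2, max_eq_right h1.1]
      intro y
      refine tendsto_const_nhds.congr' ?_
      filter_upwards [hev y, hev (T y)] with n h1 h2
      rw [h1, h2]
    calc ∫⁻ y, ENNReal.ofReal (w (T y) - w y + c) ∂μ
        = ∫⁻ y, liminf (fun n => ENNReal.ofReal (k n (T y) - k n y + c)) atTop ∂μ :=
          lintegral_congr fun y => (hlim y).liminf_eq.symm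
      _ ≤ liminf (fun n => ∫⁻ y, ENNReal.ofReal (k n (T y) - k n y + c) ∂μ) atTop :=
          lintegral_liminf_le fun n => ((((hk n).comp hT.measurable).sub (hk n)).add_const
            c).ennreal_ofReal
      _ = ENNReal.ofReal c := by simp [hn]
  -- If `c < 0`, the bound also holds with `0` in place of `c`, so the coboundary has integral at
  -- most `0`, although it is at least `-c > 0`.
  have hc : 0 ≤ c := by
    by_contra hc
    push Not at hc
    have h0 := key 0 le_rfl (by filter_upwards [h] with y hy; linarith)
    have h1 : ∫⁻ _, ENNReal.ofReal (-c) ∂μ ≤ 0 := by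
      refine le_trans (lintegral_mono_ae ?_) (h0.trans (by simp))
      filter_upwards [h] with y hy
      exact ENNReal.ofReal_le_ofReal (by linarith)
    simp at h1
    linarith
  exact ⟨hc, key c hc h⟩

end Coboundary

/-! ### Shapes of atoms and the normalized Haar measures on them -/

section Shapes

variable {G Y : Type*} [Group G] [MulAction G Y]

theorem atom_translate (g : G) (𝒜 : MeasurableSpace Y) (y : Y) :
    atom (translate g 𝒜) y = {z | g⁻¹ • z ∈ atom 𝒜 (g⁻¹ • y)} := by
  ext z
  simp only [atom, measurableAtom, mem_iInter, mem_ofPred_eq]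
  constructor
  · intro h s hs hm
    exact h ((fun y => g⁻¹ • y) ⁻¹' s) hs ⟨s, hm, rfl⟩
  · rintro h _ hy ⟨s, hm, rfl⟩
    exact h s hy hm

theorem translate_pow_le {a : G} {𝒜 : MeasurableSpace Y} (h : IsDescending a 𝒜) (j : ℕ) :
    translate (a ^ j) 𝒜 ≤ 𝒜 := by
  induction j with
  | zero =>
    simp only [translate, pow_zero, inv_one, one_smul]
    exact (MeasurableSpace.comap_id (m := 𝒜)).le
  | succ j ih =>
    have : translate (a ^ (j + 1)) 𝒜 = translate a (translate (a ^ j) 𝒜) := by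
      simp only [translate, MeasurableSpace.comap_comp]
      congr 1
      ext y
      simp [pow_succ', mul_smul]
    rw [this]
    exact (MeasurableSpace.comap_mono ih).trans h

/-- Conjugation by an element of the normalizer of `L`, as an automorphism of `L`. -/
def conjEquiv [TopologicalSpace G] [IsTopologicalGroup G] (L : Subgroup G) (g : G)
    (hg : g ∈ Subgroup.normalizer (L : Set G)) : L ≃ₜ* L where
  toFun l := ⟨g * l * g⁻¹, (Subgroup.mem_normalizer_iff.1 hg l).1 l.2⟩
  invFun l := ⟨g⁻¹ * l * g, by
    have := (Subgroup.mem_normalizer_iff.1 (inv_mem hg) l).1 l.2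
    simpa using this⟩
  left_inv l := by ext; simp [mul_assoc]
  right_inv l := by ext; simp [mul_assoc]
  map_mul' x y := by ext; simp [mul_assoc]
  continuous_toFun := by fun_prop
  continuous_invFun := by fun_prop

/-- This is how the modulus of conjugation enters: the shape for `g 𝒜` at `y` is the conjugate of
the shape for `𝒜` at `g⁻¹ • y`. -/
theorem conjEquiv_preimage_shape [TopologicalSpace G] [IsTopologicalGroup G] (L : Subgroup G)
    (g : G) (hg : g ∈ Subgroup.normalizer (L : Set G)) (𝒜 : MeasurableSpace Y) (y : Y) :
    conjEquiv L g hg ⁻¹' shape L (translate g 𝒜) y = shape L 𝒜 (g⁻¹ • y) := by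
  ext l
  simp only [shape, mem_preimage, atom_translate, mem_ofPred_eq]
  have : g⁻¹ • conjEquiv L g hg l • y = l • g⁻¹ • y := by
    change g⁻¹ • ((g * l * g⁻¹ : G)) • y = (l : G) • g⁻¹ • y
    simp [smul_smul, mul_assoc]
  rw [this]

theorem shape_anti (L : Subgroup G) {𝒞 𝒜 : MeasurableSpace Y} (h : 𝒞 ≤ 𝒜) (y : Y) :
    shape L 𝒜 y ⊆ shape L 𝒞 y := fun _ hl => atom_anti h y hl

variable (L : Subgroup G) [MeasurableSpace L] (mL : Measure L) {𝒞 𝒜 : MeasurableSpace Y}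
  [ℬ : MeasurableSpace Y] [MeasurableSMul₂ L Y]

theorem measurableSet_shape_prod (hgen : @MeasurableSpace.CountablyGenerated Y 𝒞)
    (h𝒞 : 𝒞 ≤ ℬ) : MeasurableSet {x : Y × L | x.2 ∈ shape L 𝒞 x.1} := by
  simp only [shape, mem_ofPred_eq, mem_atom_iff hgen]
  have hq : Measurable (atomMap 𝒞 hgen) := (measurable_atomMap 𝒞 hgen).mono h𝒞 le_rfl
  exact measurableSet_eq_fun (hq.comp (measurable_snd.smul measurable_fst))
    (hq.comp measurable_fst)

theorem measurableSet_shape (hgen : @MeasurableSpace.CountablyGenerated Y 𝒞)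
    (h𝒞 : 𝒞 ≤ ℬ) (y : Y) : MeasurableSet (shape L 𝒞 y) :=
  measurable_prodMk_left (measurableSet_shape_prod L hgen h𝒞)

theorem measurable_measure_shape [SFinite mL] (hgen : @MeasurableSpace.CountablyGenerated Y 𝒞)
    (h𝒞 : 𝒞 ≤ ℬ) : Measurable fun y => mL (shape L 𝒞 y) :=
  measurable_measure_prodMk_left (measurableSet_shape_prod L hgen h𝒞)

theorem tau_apply (hgen : @MeasurableSpace.CountablyGenerated Y 𝒞) (h𝒞 : 𝒞 ≤ ℬ) (y : Y)
    {D : Set Y} (hD : MeasurableSet D) :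
    tau 𝒞 L mL y D = (mL (shape L 𝒞 y))⁻¹ * mL (shape L 𝒞 y ∩ {l | l • y ∈ D}) := by
  rw [tau, Measure.map_apply (measurable_smul_const y) hD,
    cond_apply (measurableSet_shape L hgen h𝒞 y)]
  rfl

theorem measurable_tau [SFinite mL] (hgen : @MeasurableSpace.CountablyGenerated Y 𝒞)
    (h𝒞 : 𝒞 ≤ ℬ) : Measurable (tau 𝒞 L mL) := by
  refine Measure.measurable_of_measurable_coe _ fun D hD => ?_
  simp_rw [tau_apply L mL hgen h𝒞 _ hD]
  refine (measurable_measure_shape L mL hgen h𝒞).inv.mul ?_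
  exact measurable_measure_prodMk_left (s := {x : Y × L | x.2 ∈ shape L 𝒞 x.1} ∩
    (fun x : Y × L => x.2 • x.1) ⁻¹' D)
    ((measurableSet_shape_prod L hgen h𝒞).inter ((measurable_snd.smul measurable_fst) hD))

theorem tau_univ_le (hgen : @MeasurableSpace.CountablyGenerated Y 𝒞) (h𝒞 : 𝒞 ≤ ℬ) (y : Y) :
    tau 𝒞 L mL y univ ≤ 1 := by
  rw [tau_apply L mL hgen h𝒞 y MeasurableSet.univ]
  simp

/-- The measures `τ_y` as a kernel. -/
noncomputable def tauKernel [SFinite mL] (hgen : @MeasurableSpace.CountablyGenerated Y 𝒞)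
    (h𝒞 : 𝒞 ≤ ℬ) : Kernel Y Y :=
  ⟨tau 𝒞 L mL, measurable_tau L mL hgen h𝒞⟩

instance [SFinite mL] (hgen : @MeasurableSpace.CountablyGenerated Y 𝒞) (h𝒞 : 𝒞 ≤ ℬ) :
    IsFiniteKernel (tauKernel L mL hgen h𝒞) :=
  ⟨1, ENNReal.one_lt_top, tau_univ_le L mL hgen h𝒞⟩

/-- `τ` depends only on the atom, within an orbit of `L`: the normalization cancels the modular
character. -/
theorem tau_smul [TopologicalSpace G] [IsTopologicalGroup G] [LocallyCompactSpace L] [BorelSpace L]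
    [mL.IsHaarMeasure] [mL.InnerRegular]
    (hgen : @MeasurableSpace.CountablyGenerated Y 𝒞) (h𝒞 : 𝒞 ≤ ℬ) {y : Y} {l : L}
    (h : l • y ∈ atom 𝒞 y) : tau 𝒞 L mL (l • y) = tau 𝒞 L mL y := by
  have hat : atom 𝒞 (l • y) = atom 𝒞 y := @measurableAtom_eq_of_mem Y 𝒞 _ _ h
  -- Moving the base point translates the shape on the right, while `mL` is left invariant; hence
  -- the modular character.
  have hs : shape L 𝒞 (l • y) = (· * l) ⁻¹' shape L 𝒞 y := by
    ext x; simp [shape, hat, mul_smul]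
  have hright : ∀ S : Set L, MeasurableSet S →
      mL ((· * l) ⁻¹' S) = Measure.modularCharacterFun l * mL S := fun S hS => by
    rw [← Measure.map_apply (measurable_mul_const l) hS,
      Measure.map_right_mul_eq_modularCharacterFun_smul mL l]
    rfl
  have hV := measurableSet_shape L hgen h𝒞 y
  ext D hD
  have hD' : MeasurableSet {x : L | x • y ∈ D} := measurable_smul_const y hD
  have hs2 : shape L 𝒞 (l • y) ∩ {x | x • l • y ∈ D} =
      (· * l) ⁻¹' (shape L 𝒞 y ∩ {x | x • y ∈ D}) := by
    rw [hs]; ext x; simp [mul_smul]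
  have hc : (Measure.modularCharacterFun l : ℝ≥0∞) ≠ 0 := by
    exact_mod_cast (Measure.modularCharacterFun_pos l).ne'
  rw [tau_apply L mL hgen h𝒞 _ hD, tau_apply L mL hgen h𝒞 _ hD, hs2, hs, hright _ hV,
    hright _ (hV.inter hD'), ENNReal.mul_inv (Or.inl hc) (Or.inl ENNReal.coe_ne_top),
    mul_mul_mul_comm, ENNReal.inv_mul_cancel hc ENNReal.coe_ne_top, one_mul]

theorem tau_atom (hgen : @MeasurableSpace.CountablyGenerated Y 𝒞) (h𝒞 : 𝒞 ≤ ℬ)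
    (hgen' : @MeasurableSpace.CountablyGenerated Y 𝒜) (h𝒜 : 𝒜 ≤ ℬ) (h : 𝒞 ≤ 𝒜) (y : Y) :
    tau 𝒞 L mL y (atom 𝒜 y) = (mL (shape L 𝒞 y))⁻¹ * mL (shape L 𝒜 y) := by
  have hm : MeasurableSet (atom 𝒜 y) := by
    rw [atom_eq_fiber hgen']
    exact measurableSet_fiber_at ((measurable_atomMap 𝒜 hgen').mono h𝒜 le_rfl) y
  rw [tau_apply L mL hgen h𝒞 _ hm]
  congr 2
  exact inter_eq_self_of_subset_right (shape_anti L h y)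

end Shapes

/-! ### Trivial stabilizers from Poincaré recurrence -/

section Recurrence

variable {G : Type*} [Group G] [TopologicalSpace G] [IsTopologicalGroup G]

/-- If `u` fixes `hgΓ`, then `(hg)⁻¹ u (hg)` lies in `Γ`. For `u` and `h` near the identity it is
also in a neighbourhood that meets the discrete group `Γ` only in `1`. -/
theorem exists_nhds_smul_ne (Γ : Subgroup G) [DiscreteTopology Γ] (y : G ⧸ Γ) :
    ∃ U ∈ 𝓝 (1 : G), ∃ N ∈ 𝓝 y, ∀ u ∈ U, ∀ z ∈ N, u • z = z → u = 1 := by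
  obtain ⟨g, rfl⟩ := QuotientGroup.mk_surjective y
  have h1 : {(1 : Γ)} ∈ 𝓝 (1 : Γ) := by simp
  rw [nhds_subtype, mem_comap] at h1
  obtain ⟨W, hW, hW1⟩ := h1
  have hc : Continuous fun x : G × G => (x.2 * g)⁻¹ * x.1 * (x.2 * g) := by fun_prop
  have hW' : (fun x : G × G => (x.2 * g)⁻¹ * x.1 * (x.2 * g)) ⁻¹' W ∈ 𝓝 ((1 : G), (1 : G)) :=
    hc.continuousAt (by simpa using hW)
  rw [nhds_prod_eq, mem_prod_iff] at hW'
  obtain ⟨U, hU, N, hN, hUN⟩ := hW'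
  refine ⟨U, hU, (fun h : G => ((h * g : G) : G ⧸ Γ)) '' N, ?_, ?_⟩
  · have ho : IsOpenMap fun h : G => ((h * g : G) : G ⧸ Γ) :=
      QuotientGroup.isOpenMap_coe.comp (isOpenMap_mul_right g)
    simpa using ho.image_mem_nhds hN
  · rintro u hu _ ⟨h, hh, rfl⟩ hz
    have hz' : ((u * (h * g) : G) : G ⧸ Γ) = ((h * g : G) : G ⧸ Γ) := hz
    have hmem : (h * g)⁻¹ * (u * (h * g)) ∈ Γ := QuotientGroup.eq.1 hz'.symm
    have hw : (h * g)⁻¹ * u * (h * g) ∈ W := hUN (mk_mem_prod hu hh)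
    rw [mul_assoc] at hw
    have := hW1 (show (⟨_, hmem⟩ : Γ) ∈ _ from hw)
    rw [mem_singleton_iff, Subtype.ext_iff] at this
    simp only [Subgroup.coe_one] at this
    rw [inv_mul_eq_one] at this
    exact (mul_eq_right.1 this.symm)

/-- By Poincaré recurrence, almost every point has trivial stabilizer in `G⁺`. -/
theorem ae_unstable_smul_ne [SecondCountableTopology G] (Γ : Subgroup G) [DiscreteTopology Γ]
    [MeasurableSpace (G ⧸ Γ)] [BorelSpace (G ⧸ Γ)] {a : G} {μ : Measure (G ⧸ Γ)}
    [IsFiniteMeasure μ] (hμ : MeasurePreserving (fun y : G ⧸ Γ => a • y) μ μ) :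
    ∀ᵐ y ∂μ, ∀ l ∈ unstable a, l • y = y → l = 1 := by
  have hinv : MeasurePreserving (fun y : G ⧸ Γ => a⁻¹ • y) μ μ := by
    have := MeasurePreserving.symm (Homeomorph.smul a).toMeasurableEquiv hμ
    exact this
  have hrec := hinv.conservative.ae_frequently_mem_of_mem_nhds
  filter_upwards [hrec] with y hy l hl hly
  obtain ⟨U, hU, N, hN, hUN⟩ := exists_nhds_smul_ne Γ y
  have hl' : Tendsto (fun n : ℕ => a ^ (-(n : ℤ)) * l * a ^ (n : ℤ)) atTop (𝓝 1) := by
    have h1 : Tendsto (fun n : ℕ => -(n : ℤ)) atTop atBot :=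
      tendsto_neg_atTop_atBot.comp tendsto_natCast_atTop_atTop
    have := Tendsto.comp hl h1
    simpa [Function.comp_def] using this
  -- If `l` fixes `y`, then `a⁻ⁿ l aⁿ` fixes `a⁻ⁿ • y`. These conjugates tend to `1` while `a⁻ⁿ • y`
  -- returns to `N` infinitely often.
  obtain ⟨n, hn1, hn2⟩ := ((hy N hN).and_eventually (hl' hU)).exists
  have hit : (fun y : G ⧸ Γ => a⁻¹ • y)^[n] y = a ^ (-(n : ℤ)) • y := by
    rw [smul_iterate]; simp
  rw [hit] at hn1
  have := hUN _ hn2 _ hn1 (by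
    rw [smul_smul, mul_assoc, mul_assoc, ← zpow_add, add_neg_cancel, zpow_zero, mul_one, mul_smul,
      hly])
  rwa [mul_eq_one_iff_eq_inv, ← zpow_neg, mul_eq_left] at this

end Recurrence

/-! ### The entropy estimate in terms of the modulus -/

section Main

theorem properSpace_of_isClosed {X : Type*} [MetricSpace X] [ProperSpace X] {s : Set X}
    (hs : IsClosed s) : ProperSpace s :=
  ⟨fun x r => hs.isClosedEmbedding_subtypeVal.isCompact_preimage
    (isCompact_closedBall (x : X) r)⟩

variable {G : Type*} [Group G] [MetricSpace G] [IsTopologicalGroup G]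
  {Γ : Subgroup G} {𝒜 : MeasurableSpace (G ⧸ Γ)}
  [ℬ : MeasurableSpace (G ⧸ Γ)] [BorelSpace (G ⧸ Γ)] {a : G}
  {L : Subgroup G} [MeasurableSpace L] (mL : Measure L) [mL.IsHaarMeasure]
  {μ : Measure (G ⧸ Γ)}

theorem measurePreserving_pow_inv_smul
    (hμ : MeasurePreserving (fun y : G ⧸ Γ => a • y) μ μ) (j : ℕ) :
    MeasurePreserving (fun y : G ⧸ Γ => (a ^ j)⁻¹ • y) μ μ := by
  have hinv : MeasurePreserving (fun y : G ⧸ Γ => a⁻¹ • y) μ μ :=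
    MeasurePreserving.symm (Homeomorph.smul a).toMeasurableEquiv hμ
  have := hinv.iterate j
  rwa [smul_iterate, inv_pow] at this

variable [ProperSpace G] [DiscreteTopology Γ]

/-- Subordination gives the inner ball at once. The outer ball bounds the shape only where `l ↦ l •
y` is injective, since the shape contains the whole stabilizer of `y` in `L`. -/
theorem ae_measure_shape_ne [IsFiniteMeasure μ] (hLclosed : IsClosed (L : Set G))
    (hLG : (L : Set G) ⊆ unstable a) (hμ : MeasurePreserving (fun y : G ⧸ Γ => a • y) μ μ)
    (hsub : IsSubordinate 𝒜 L μ) :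
    ∀ᵐ y ∂μ, mL (shape L 𝒜 y) ≠ 0 ∧ mL (shape L 𝒜 y) ≠ ⊤ := by
  have : ProperSpace L := properSpace_of_isClosed hLclosed
  filter_upwards [ae_unstable_smul_ne Γ hμ, hsub] with y h1 h2
  obtain ⟨δ, hδ, hin, hout⟩ := h2
  constructor
  · refine fun h0 => (Metric.measure_ball_pos mL (1 : L) hδ).ne' (measure_mono_null ?_ h0)
    exact fun l hl => hin ⟨l, hl, rfl⟩
  · refine ne_top_of_le_ne_top (measure_ball_lt_top (μ := mL) (x := (1 : L)) (r := δ⁻¹)).ne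
      (measure_mono fun l hl => ?_)
    obtain ⟨b, hb, hbl⟩ := hout hl
    have : b⁻¹ * l = 1 := by
      ext
      refine h1 _ (hLG (b⁻¹ * l).2) ?_
      have hbl' : b • y = l • y := hbl
      change (b⁻¹ * l) • y = y
      rw [mul_smul, ← hbl', inv_smul_smul]
    rw [inv_mul_eq_one] at this
    rwa [← this]

variable [BorelSpace L]

theorem lintegral_negLog_tau_atom_le [IsProbabilityMeasure μ] (hLclosed : IsClosed (L : Set G))
    (hLG : (L : Set G) ⊆ unstable a) (haL : a ∈ Subgroup.normalizer (L : Set G))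
    (hμ : MeasurePreserving (fun y : G ⧸ Γ => a • y) μ μ) (j : ℕ) (h𝒜 : 𝒜 ≤ ℬ)
    (hgen : @MeasurableSpace.CountablyGenerated (G ⧸ Γ) 𝒜)
    (hdesc : IsDescending a 𝒜) (hsub : IsSubordinate 𝒜 L μ) [LocallyCompactSpace L] :
    0 ≤ Real.log (mulEquivHaarChar (conjEquiv L (a ^ j) (pow_mem haL j))) ∧
    ∫⁻ y, negLog (tau (translate (a ^ j) 𝒜) L mL y (atom 𝒜 y)) ∂μ ≤
      ENNReal.ofReal (Real.log (mulEquivHaarChar (conjEquiv L (a ^ j) (pow_mem haL j)))) := by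
  have : ProperSpace L := properSpace_of_isClosed hLclosed
  set φ := conjEquiv L (a ^ j) (pow_mem haL j)
  have h𝒞𝒜 : translate (a ^ j) 𝒜 ≤ 𝒜 := translate_pow_le hdesc j
  have hgen' : @MeasurableSpace.CountablyGenerated (G ⧸ Γ) (translate (a ^ j) 𝒜) :=
    @MeasurableSpace.CountablyGenerated.comap _ _ 𝒜 hgen _
  have hT := measurePreserving_pow_inv_smul hμ j
  have hne := ae_measure_shape_ne mL hLclosed hLG hμ hsub
  have hneT := hT.quasiMeasurePreserving.ae hne
  have hφ : mulEquivHaarChar φ ≠ 0 := (mulEquivHaarChar_pos φ).ne'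
  have hφpos : (0 : ℝ) < mulEquivHaarChar φ := by exact_mod_cast mulEquivHaarChar_pos φ
  -- Nothing makes this log-volume integrable, so its integrals cannot simply be cancelled;
  -- `lintegral_coboundary_add_le` replaces that.
  let w : G ⧸ Γ → ℝ := fun y => Real.log (mL (shape L 𝒜 y)).toReal
  have hw : Measurable w :=
    Real.measurable_log.comp (measurable_measure_shape L mL hgen h𝒜).ennreal_toReal
  have key : ∀ᵐ y ∂μ, 0 ≤ w ((a ^ j)⁻¹ • y) - w y + Real.log (mulEquivHaarChar φ) ∧
      negLog (tau (translate (a ^ j) 𝒜) L mL y (atom 𝒜 y)) =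
        ENNReal.ofReal (w ((a ^ j)⁻¹ • y) - w y + Real.log (mulEquivHaarChar φ)) := by
    filter_upwards [hne, hneT] with y ⟨h0, h1⟩ ⟨h0', h1'⟩
    have hsh : mL (shape L (translate (a ^ j) 𝒜) y) =
        mulEquivHaarChar φ * mL (shape L 𝒜 ((a ^ j)⁻¹ • y)) := by
      rw [← mulEquivHaarChar_smul_preimage mL φ, conjEquiv_preimage_shape]
      rfl
    have ht := tau_atom L mL hgen' (h𝒞𝒜.trans h𝒜) hgen h𝒜 h𝒞𝒜 y
    have hle : tau (translate (a ^ j) 𝒜) L mL y (atom 𝒜 y) ≤ 1 :=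
      (measure_mono (subset_univ _)).trans (tau_univ_le L mL hgen' (h𝒞𝒜.trans h𝒜) y)
    rw [hsh] at ht
    have p0 := ENNReal.toReal_pos h0 h1
    have p0' := ENNReal.toReal_pos h0' h1'
    have htr : (tau (translate (a ^ j) 𝒜) L mL y (atom 𝒜 y)).toReal =
        (mulEquivHaarChar φ * (mL (shape L 𝒜 ((a ^ j)⁻¹ • y))).toReal)⁻¹ *
          (mL (shape L 𝒜 y)).toReal := by
      rw [ht]; simp
    have hlog : -Real.log (tau (translate (a ^ j) 𝒜) L mL y (atom 𝒜 y)).toReal =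
        w ((a ^ j)⁻¹ • y) - w y + Real.log (mulEquivHaarChar φ) := by
      rw [htr, Real.log_mul (by positivity) (by positivity), Real.log_inv,
        Real.log_mul (by positivity) (by positivity)]
      simp only [w]
      ring
    constructor
    · rw [← hlog, Left.nonneg_neg_iff]
      refine Real.log_nonpos ENNReal.toReal_nonneg ?_
      simpa using ENNReal.toReal_mono ENNReal.one_ne_top hle
    · rw [← hlog, negLog_eq_ofReal _ (ne_top_of_le_ne_top ENNReal.one_ne_top hle)]
      intro hz
      rw [hz] at htr
      simp only [ENNReal.toReal_zero] at htr
      have : 0 < (mulEquivHaarChar φ * (mL (shape L 𝒜 ((a ^ j)⁻¹ • y))).toReal)⁻¹ *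
          (mL (shape L 𝒜 y)).toReal := by positivity
      linarith
  have := lintegral_coboundary_add_le hT hw (key.mono fun y hy => hy.1)
  refine ⟨this.1, ?_⟩
  rw [lintegral_congr_ae (key.mono fun y hy => hy.2)]
  exact this.2

/-- The entropy estimate, in terms of the modulus of the conjugation by `a ^ j` on `L`. -/
theorem condEntropy_add_lintegral_negLog_le [IsProbabilityMeasure μ]
    (hLclosed : IsClosed (L : Set G))
    (hLG : (L : Set G) ⊆ unstable a) (haL : a ∈ Subgroup.normalizer (L : Set G))
    (hμ : MeasurePreserving (fun y : G ⧸ Γ => a • y) μ μ) (j : ℕ) (h𝒜 : 𝒜 ≤ ℬ)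
    (hgen : @MeasurableSpace.CountablyGenerated (G ⧸ Γ) 𝒜)
    (hdesc : IsDescending a 𝒜) (hsub : IsSubordinate 𝒜 L μ) [LocallyCompactSpace L]
    {K : Set (G ⧸ Γ)} {B : Set L} (hBsymm : B⁻¹ = B)
    (hKB : ∀ y ∈ K, atom 𝒜 y ⊆ (fun b : L => b • y) '' B) :
    condEntropy 𝒜 (translate (a ^ j) 𝒜) μ +
      ∫⁻ y, negLog (tau (translate (a ^ j) 𝒜) L mL y (Kᶜ ∪ B • μ.support)) ∂μ ≤
      ENNReal.ofReal (Real.log (mulEquivHaarChar (conjEquiv L (a ^ j) (pow_mem haL j)))) := by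
  have : ProperSpace L := properSpace_of_isClosed hLclosed
  have h𝒞𝒜 : translate (a ^ j) 𝒜 ≤ 𝒜 := translate_pow_le hdesc j
  have h𝒞 := h𝒞𝒜.trans h𝒜
  have hgen' : @MeasurableSpace.CountablyGenerated (G ⧸ Γ) (translate (a ^ j) 𝒜) :=
    @MeasurableSpace.CountablyGenerated.comap _ _ 𝒜 hgen _
  have hT := measurePreserving_pow_inv_smul hμ j
  have hne := ae_measure_shape_ne mL hLclosed hLG hμ hsub
  have hneT := hT.quasiMeasurePreserving.ae hne
  set κ := condKernel μ h𝒞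
  set τ := tauKernel L mL hgen' h𝒞
  set p := atomMap 𝒜 hgen
  set q := atomMap (translate (a ^ j) 𝒜) hgen'
  have hp : Measurable p := (measurable_atomMap 𝒜 hgen).mono h𝒜 le_rfl
  have hpq : ∀ y z, p z = p y → q z = q y := fun y z h =>
    (mem_atom_iff hgen').1 (atom_anti h𝒞𝒜 y ((mem_atom_iff hgen).2 h))
  have hκ : ∀ y z, q z = q y → κ z = κ y := condKernel_congr h𝒞 hgen'
  have hκq : ∀ᵐ y ∂μ, ∀ᵐ z ∂κ y, q z = q y := ae_condKernel_atomMap_eq h𝒞 hgen'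
  have hκμ : κ ∘ₘ μ = μ := condKernel_comp h𝒞
  -- Subordination at `a^{-j} • y`, conjugated by `a^j`, puts the `a^j 𝒜`-atom of `y` in one
  -- `L`-orbit, as `tau_smul` requires.
  have hτ : ∀ᵐ y ∂μ, ∀ z, q z = q y → τ z = τ y := by
    filter_upwards [hT.quasiMeasurePreserving.ae hsub] with y hy z hz
    obtain ⟨δ, -, -, hout⟩ := hy
    have hz' : z ∈ atom (translate (a ^ j) 𝒜) y := (mem_atom_iff hgen').2 hz
    have hz'' := hz'
    rw [atom_translate] at hz''
    obtain ⟨l, -, hl⟩ := hout hz''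
    have hl' : z = conjEquiv L (a ^ j) (pow_mem haL j) l • y := by
      have : (l : G) • (a ^ j)⁻¹ • y = (a ^ j)⁻¹ • z := hl
      change z = ((a ^ j) * (l : G) * (a ^ j)⁻¹) • y
      rw [mul_smul, mul_smul, this, smul_inv_smul]
    rw [hl'] at hz' ⊢
    exact tau_smul L mL hgen' h𝒞 hz'
  have hpos : ∀ᵐ y ∂μ, τ y {z | p z = p y} ≠ 0 := by
    filter_upwards [hne, hneT] with y ⟨h0, h1⟩ ⟨h0', h1'⟩
    rw [← atom_eq_fiber hgen]
    change tau (translate (a ^ j) 𝒜) L mL y (atom 𝒜 y) ≠ 0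
    rw [tau_atom L mL hgen' h𝒞 hgen h𝒜 h𝒞𝒜 y]
    refine mul_ne_zero (ENNReal.inv_ne_zero.2 ?_) h0
    rw [← mulEquivHaarChar_smul_preimage mL (conjEquiv L (a ^ j) (pow_mem haL j)),
      conjEquiv_preimage_shape]
    exact ENNReal.mul_ne_top ENNReal.coe_ne_top h1'
  have hsupp : MeasurableSet μ.support := μ.isClosed_support.measurableSet
  -- Jensen needs a measurable set saturated for `𝒜`. This `D` is one by construction, has full
  -- measure and is contained in `Kᶜ ∪ B • Supp μ`.
  set D : Set (G ⧸ Γ) := {z | κ z {w | p w = p z} ≠ 0} ∩ {z | κ z μ.supportᶜ = 0}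
  have hD : MeasurableSet D :=
    (measurable_kernel_fiber hp κ (measurableSet_singleton 0)).compl.inter
      (κ.measurable_coe hsupp.compl (measurableSet_singleton 0))
  have hsat : ∀ y z, p z = p y → (z ∈ D ↔ y ∈ D) := by
    intro y z h
    simp only [D, mem_inter_iff, mem_ofPred_eq, hκ y z (hpq y z h), h]
  have hDμ : ∀ᵐ y ∂μ, y ∈ D := by
    have hs : ∀ᵐ y ∂μ, ∀ᵐ z ∂κ y, z ∈ μ.support :=
      Measure.ae_ae_of_ae_comp (by rw [hκμ]; exact Measure.support_mem_ae)
    filter_upwards [ae_kernel_fiber_ne_zero hp hκμ hκ hκq hτ hpos, hs] with y h1 h2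
    exact ⟨h1, h2⟩
  have hDS : D ⊆ Kᶜ ∪ B • μ.support := by
    rintro z ⟨hz1, hz2⟩
    by_cases hzK : z ∈ K
    · right
      -- An atom of positive `κ z`-mass cannot miss a set of full `κ z`-mass.
      obtain ⟨w, hw1, hw2⟩ : ({w | p w = p z} ∩ μ.support).Nonempty := by
        by_contra hemp
        rw [not_nonempty_iff_eq_empty] at hemp
        exact hz1 (measure_mono_null (fun w hw hw' =>
          (Set.ext_iff.1 hemp w).1 ⟨hw, hw'⟩) hz2)
      obtain ⟨b, hb, hbw⟩ := hKB z hzK ((mem_atom_iff hgen).2 hw1)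
      refine ⟨b⁻¹, by rw [← hBsymm]; simpa using hb, w, hw2, ?_⟩
      have : b • z = w := hbw
      change b⁻¹ • w = z
      rw [← this, inv_smul_smul]
    · exact Or.inl hzK
  have h1 := lintegral_negLog_add_le hp hκμ hκ hκq hτ (tau_univ_le L mL hgen' h𝒞) hpos hD hsat hDμ
  have h2 := (lintegral_negLog_tau_atom_le mL hLclosed hLG haL hμ j h𝒜 hgen hdesc hsub).2
  have h3 : condEntropy 𝒜 (translate (a ^ j) 𝒜) μ = ∫⁻ y, negLog (κ y {z | p z = p y}) ∂μ := by
    refine lintegral_congr fun y => ?_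
    rw [information, atom_eq_fiber hgen]
    rfl
  calc _ ≤ ∫⁻ y, negLog (κ y {z | p z = p y}) ∂μ + ∫⁻ y, negLog (τ y D) ∂μ := by
        rw [h3]
        gcongr with y
        exact negLog_anti (measure_mono hDS)
    _ ≤ _ := h1
    _ ≤ _ := by
        refine le_trans (le_of_eq (lintegral_congr fun y => ?_)) h2
        rw [atom_eq_fiber hgen]
        rfl

end Main

/-! ### Haar measure of small balls in a first-order model of a group -/

section LocalModel

variable {F : Type*} [NormedAddCommGroup F] {L : Type*} [Group L] [TopologicalSpace L]
  [IsTopologicalGroup L]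

/-- A map from a topological group to a normed space that near the identity behaves like a
chart whose derivative at the identity is the identity. -/
structure IsLocalModel (f : L → F) (U : Set L) : Prop where
  isOpen : IsOpen U
  one_mem : (1 : L) ∈ U
  map_one : f 1 = 0
  continuousOn : ContinuousOn f U
  mem_of_small : ∀ V ∈ 𝓝 (1 : L), ∃ ρ > 0, ∀ x ∈ U, ‖f x‖ < ρ → x ∈ V
  map_mul : ∀ ε > 0, ∃ V ∈ 𝓝 (1 : L), ∀ x ∈ V, ∀ z ∈ V, ‖f (x * z) - f x - f z‖ ≤ ε * ‖f z‖
  image_mem : ∀ V ∈ 𝓝 (1 : L), f '' V ∈ 𝓝 (0 : F)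

variable [MeasurableSpace L] [BorelSpace L] {f : L → F} {U : Set L}

/-- The Haar measure of small translated balls, in a local model. -/
theorem IsLocalModel.measure_ball (hf : IsLocalModel f U) (m : Measure L) [m.IsHaarMeasure]
    {c : ℝ} (hc : 1 < c) :
    ∃ ρ > 0, ∀ z : F, ‖z‖ < ρ → ∀ s < ρ,
      m (U ∩ f ⁻¹' Metric.ball z s) ≤ m (U ∩ f ⁻¹' Metric.ball 0 (c * s)) ∧
      m (U ∩ f ⁻¹' Metric.ball 0 (s / c)) ≤ m (U ∩ f ⁻¹' Metric.ball z s) := by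
  have hc0 : 0 < c := by linarith
  -- With this error, left translation in the model distorts radii by at most `c` both ways: `1 - ε
  -- = c⁻¹`, and `1 + ε ≤ c` by `hcc`.
  have hε : 0 < 1 - c⁻¹ := by
    have := inv_lt_one_of_one_lt₀ hc
    linarith
  obtain ⟨V₁, hV₁, hmul⟩ := hf.map_mul _ hε
  have hUn : U ∈ 𝓝 (1 : L) := hf.isOpen.mem_nhds hf.one_mem
  have hdiv : Tendsto (fun x : L × L => x.1⁻¹ * x.2) (𝓝 (1, 1)) (𝓝 1) := by
    have : Continuous fun x : L × L => x.1⁻¹ * x.2 := by fun_prop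
    simpa using this.tendsto (1, 1)
  have hmu : Tendsto (fun x : L × L => x.1 * x.2) (𝓝 (1, 1)) (𝓝 1) := by
    have : Continuous fun x : L × L => x.1 * x.2 := by fun_prop
    simpa using this.tendsto (1, 1)
  have hpre := inter_mem (mem_map.1 (hdiv (inter_mem hV₁ hUn))) (mem_map.1 (hmu hUn))
  rw [nhds_prod_eq, mem_prod_iff] at hpre
  obtain ⟨S, hS, S', hS', hSS⟩ := hpre
  set V₂ := S ∩ S' ∩ V₁ ∩ U
  have hV₂ : V₂ ∈ 𝓝 (1 : L) := inter_mem (inter_mem (inter_mem hS hS') hV₁) hUn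
  obtain ⟨ρ₁, hρ₁, hsmall⟩ := hf.mem_of_small V₂ hV₂
  obtain ⟨ρ₂, hρ₂, hball⟩ := Metric.mem_nhds_iff.1 (hf.image_mem V₂ hV₂)
  refine ⟨min (ρ₁ / 2) ρ₂, by positivity, fun z hz s hs => ?_⟩
  obtain ⟨x, hx, rfl⟩ := hball (by simpa using hz.trans_le (min_le_right _ _))
  have hz1 : ‖f x‖ < ρ₁ / 2 := hz.trans_le (min_le_left _ _)
  have hs1 : s < ρ₁ / 2 := hs.trans_le (min_le_left _ _)
  have hcc : 1 - c⁻¹ ≤ c - 1 := by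
    have : 0 ≤ (c - 1) ^ 2 / c := by positivity
    have e : (c - 1) ^ 2 / c = c - 1 - (1 - c⁻¹) := by field_simp
    linarith
  constructor
  · rw [← measure_preimage_mul m x⁻¹ (U ∩ f ⁻¹' Metric.ball 0 (c * s))]
    refine measure_mono fun y ⟨hyU, hy⟩ => ?_
    rw [mem_preimage, mem_ball_iff_norm] at hy
    have hyV : y ∈ V₂ := by
      refine hsmall y hyU ?_
      have := norm_add_le (f y - f x) (f x)
      rw [sub_add_cancel] at this
      linarith
    have hxy := (hSS (mk_mem_prod hx.1.1.1 hyV.1.1.2)).1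
    refine ⟨hxy.2, ?_⟩
    rw [mem_preimage, mem_ball_zero_iff]
    have h1 := hmul x hx.1.2 _ hxy.1
    rw [mul_inv_cancel_left] at h1
    have h2 := norm_sub_le (f y - f x) (f y - f x - f (x⁻¹ * y))
    rw [sub_sub_cancel] at h2
    have h3 : c⁻¹ * ‖f (x⁻¹ * y)‖ < s := by
      linarith
    rwa [inv_mul_lt_iff₀ hc0] at h3
  · rw [← measure_preimage_mul m x (U ∩ f ⁻¹' Metric.ball (f x) s)]
    refine measure_mono fun y ⟨hyU, hy⟩ => ?_
    rw [mem_preimage, mem_ball_zero_iff, lt_div_iff₀ hc0] at hy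
    have hyV : y ∈ V₂ := by
      refine hsmall y hyU ?_
      nlinarith [norm_nonneg (f y)]
    have hxy := (hSS (mk_mem_prod hx.1.1.1 hyV.1.1.2)).2
    refine ⟨hxy, ?_⟩
    rw [mem_preimage, mem_ball_iff_norm]
    have h1 := hmul x hx.1.2 y hyV.1.2
    have h2 := norm_add_le (f (x * y) - f x - f y) (f y)
    rw [sub_add_cancel] at h2
    nlinarith [norm_nonneg (f y)]

end LocalModel

/-! ### The modulus of an automorphism is at most its determinant -/

section HaarModulus

variable {F : Type*} [NormedAddCommGroup F] [MeasurableSpace F] [BorelSpace F]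

theorem setLIntegral_measure_ball [SecondCountableTopology F] (ν vol : Measure F) [SFinite ν]
    [SFinite vol] {D : Set F} (hD : MeasurableSet D) (s : ℝ) :
    ∫⁻ z in D, ν (Metric.ball z s) ∂vol = ∫⁻ w, vol (D ∩ Metric.ball w s) ∂ν := by
  have hE : MeasurableSet {x : F × F | x.1 ∈ D ∧ dist x.2 x.1 < s} :=
    (measurable_fst hD).inter
      (measurableSet_lt (measurable_snd.dist measurable_fst) measurable_const)
  have h1 := Measure.prod_apply (μ := vol) (ν := ν) hE
  rw [Measure.prod_apply_symm hE] at h1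
  rw [← lintegral_indicator hD]
  refine Eq.trans (lintegral_congr fun z => ?_) (h1.symm.trans (lintegral_congr fun w => ?_))
  · by_cases hz : z ∈ D
    · simp only [hz, indicator_of_mem, preimage_ofPred_eq, true_and]
      rfl
    · simp [hz]
  · congr 1
    ext z
    simp [dist_comm w z]

variable [NormedSpace ℝ F] [FiniteDimensional ℝ F]

/-- Averaging over balls of one small radius compares `ν` with `vol` without a density: only a
uniform bound on `ν` of those balls is used. -/
theorem measure_mul_ball_le (ν vol : Measure F) [SFinite ν] [vol.IsAddHaarMeasure] {D D' : Set F}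
    (hD : MeasurableSet D) (hD' : MeasurableSet D') {s : ℝ} {β : ℝ≥0∞}
    (h : ∀ w ∈ D, Metric.ball w s ⊆ D') (hβ : ∀ z ∈ D', ν (Metric.ball z s) ≤ β) :
    ν D * vol (Metric.ball 0 s) ≤ vol D' * β := by
  calc ν D * vol (Metric.ball 0 s) = ∫⁻ _ in D, vol (Metric.ball 0 s) ∂ν := by
        rw [lintegral_const, Measure.restrict_apply_univ, mul_comm]
    _ ≤ ∫⁻ w in D, vol (D' ∩ Metric.ball w s) ∂ν := by
        refine setLIntegral_mono' hD fun w hw => ?_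
        rw [inter_eq_self_of_subset_right (h w hw)]
        exact (Measure.addHaar_ball_center vol w s).ge
    _ ≤ ∫⁻ w, vol (D' ∩ Metric.ball w s) ∂ν := setLIntegral_le_lintegral _ _
    _ = ∫⁻ z in D', ν (Metric.ball z s) ∂vol := (setLIntegral_measure_ball ν vol hD' s).symm
    _ ≤ ∫⁻ _ in D', β ∂vol := setLIntegral_mono' hD' hβ
    _ = vol D' * β := by rw [lintegral_const, Measure.restrict_apply_univ, mul_comm]

theorem mul_le_measure_mul_ball (ν vol : Measure F) [SFinite ν] [vol.IsAddHaarMeasure]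
    {D D' : Set F} (hD : MeasurableSet D) (hD' : MeasurableSet D') {s : ℝ} {β : ℝ≥0∞}
    (h : ∀ z ∈ D', Metric.ball z s ⊆ D) (hβ : ∀ z ∈ D', β ≤ ν (Metric.ball z s)) :
    vol D' * β ≤ ν D * vol (Metric.ball 0 s) := by
  calc vol D' * β = ∫⁻ _ in D', β ∂vol := by
        rw [lintegral_const, Measure.restrict_apply_univ, mul_comm]
    _ ≤ ∫⁻ z in D', ν (Metric.ball z s) ∂vol := setLIntegral_mono' hD' hβ
    _ = ∫⁻ w, vol (D' ∩ Metric.ball w s) ∂ν := setLIntegral_measure_ball ν vol hD' s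
    _ ≤ ∫⁻ w, D.indicator (fun _ => vol (Metric.ball 0 s)) w ∂ν := by
        refine lintegral_mono fun w => ?_
        by_cases hw : w ∈ D
        · simp only [hw, indicator_of_mem]
          rw [← Measure.addHaar_ball_center vol w]
          exact measure_mono inter_subset_right
        · have : D' ∩ Metric.ball w s = ∅ := by
            ext z
            simp only [mem_inter_iff, mem_empty_iff_false, iff_false, not_and]
            intro hz hzw
            exact hw (h z hz (Metric.mem_ball_comm.1 hzw))
          simp [this]
    _ = ν D * vol (Metric.ball 0 s) := by
        rw [lintegral_indicator hD, lintegral_const, Measure.restrict_apply_univ, mul_comm]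

variable {L : Type*} [Group L] [TopologicalSpace L] [IsTopologicalGroup L]
  [MeasurableSpace L] [BorelSpace L] {f : L → F} {U : Set L}

/-- At small scale `φ` sends the model ball of radius `r` into `A(B_{cr})`. The `ν`-masses of `B_r`
and `A(B_{cr})` are both compared with their volumes through the single number `ν(B_{cs})`, which
cancels. The radii `c²r`, `c²s` and `r/c` cost `c^{2d}`, `c^{2d}` and `c^d`. -/
theorem IsLocalModel.mulEquivHaarChar_le_mul [LocallyCompactSpace L]
    (hf : IsLocalModel f U) (m : Measure L) [m.IsHaarMeasure] [m.Regular] [SFinite m]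
    (φ : L ≃ₜ* L) (A : F ≃L[ℝ] F)
    (hφ : ∀ ε > 0, ∃ V ∈ 𝓝 (1 : L), ∀ x ∈ V, ‖f (φ x) - A (f x)‖ ≤ ε * ‖f x‖)
    {c : ℝ} (hc : 1 < c) :
    (mulEquivHaarChar φ : ℝ) ≤
      |LinearMap.det (A : F →ₗ[ℝ] F)| * c ^ (5 * Module.finrank ℝ F) := by
  have hc0 : 0 < c := by linarith
  set vol : Measure F := Measure.addHaar
  set d := Module.finrank ℝ F
  have hUn : U ∈ 𝓝 (1 : L) := hf.isOpen.mem_nhds hf.one_mem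
  obtain ⟨ρ, hρ, hball⟩ := hf.measure_ball m hc
  set M : ℝ := ‖(A.symm : F →L[ℝ] F)‖ + 1
  set N : ℝ := ‖(A : F →L[ℝ] F)‖ + 1
  have hM : 0 < M := by positivity
  have hN : 0 < N := by positivity
  have hMle : ∀ v, ‖A.symm v‖ ≤ M * ‖v‖ := fun v =>
    ((A.symm : F →L[ℝ] F).le_opNorm v).trans (by gcongr; simp [M])
  have hNle : ∀ v, ‖A v‖ ≤ N * ‖v‖ := fun v =>
    ((A : F →L[ℝ] F).le_opNorm v).trans (by gcongr; simp [N])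
  obtain ⟨V, hV, hφV⟩ := hφ ((c - 1) / M) (div_pos (by linarith) hM)
  obtain ⟨C, hC, hCn⟩ := exists_compact_mem_nhds (1 : L)
  have hφU : φ ⁻¹' U ∈ 𝓝 (1 : L) := φ.continuous.continuousAt (by simpa using hUn)
  obtain ⟨ρ', hρ', hsm⟩ := hf.mem_of_small _ (inter_mem (inter_mem hV hCn) hφU)
  obtain ⟨r, hr, hr1, hr2⟩ : ∃ r > 0, r < ρ' ∧ N * (c ^ 2 * r) < ρ := by
    refine ⟨min (ρ' / 2) (ρ / (2 * N * c ^ 2)), by positivity,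
      (min_le_left _ _).trans_lt (by linarith), ?_⟩
    calc N * (c ^ 2 * min (ρ' / 2) (ρ / (2 * N * c ^ 2)))
        ≤ N * (c ^ 2 * (ρ / (2 * N * c ^ 2))) := by gcongr; exact min_le_right _ _
      _ = ρ / 2 := by field_simp
      _ < ρ := by linarith
  have hN1 : 1 ≤ N := by simp [N]
  have hrρ : r < ρ := by
    refine lt_of_le_of_lt ?_ hr2
    calc r = 1 * (1 ^ 2 * r) := by ring
      _ ≤ N * (c ^ 2 * r) := by gcongr
  have hrc : 0 < r - r / c := by
    have : r / c < r := div_lt_self hr hc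
    linarith
  -- The `s`-neighbourhood of `A(B_{cr})` must stay in `A(B_{c²r})`, the `c²s`-neighbourhood of
  -- `B_{r/c}` in `B_r`, and `hball` must apply at radius `c²s`.
  obtain ⟨s, hs, hs1, hs2, hs3⟩ :
      ∃ s > 0, M * s ≤ (c ^ 2 - c) * r ∧ c ^ 2 * s ≤ r - r / c ∧ c ^ 2 * s < ρ := by
    have hcc : 0 < c ^ 2 - c := by nlinarith
    refine ⟨min ((c ^ 2 - c) * r / M) (min ((r - r / c) / c ^ 2) (ρ / 2 / c ^ 2)),
      by positivity, ?_, ?_, ?_⟩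
    · rw [← le_div_iff₀' hM]; exact min_le_left _ _
    · rw [← le_div_iff₀' (by positivity)]; exact (min_le_right _ _).trans (min_le_left _ _)
    · have : c ^ 2 * min ((c ^ 2 - c) * r / M) (min ((r - r / c) / c ^ 2) (ρ / 2 / c ^ 2))
          ≤ ρ / 2 := by
        rw [← le_div_iff₀' (by positivity)]; exact (min_le_right _ _).trans (min_le_right _ _)
      linarith
  have hsρ : s < ρ := lt_of_le_of_lt (le_mul_of_one_le_left hs.le (one_le_pow₀ hc.le)) hs3
  have hUm := hf.isOpen.measurableSet
  have hfm : AEMeasurable f (m.restrict U) := hf.continuousOn.aemeasurable hUm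
  set ν : Measure F := (m.restrict U).map f
  have hν : ∀ {D : Set F}, MeasurableSet D → ν D = m (U ∩ f ⁻¹' D) := fun {D} hD => by
    rw [Measure.map_apply_of_aemeasurable hfm hD, Measure.restrict_apply' hUm, inter_comm]
  have hAm : ∀ t, MeasurableSet (A '' Metric.ball 0 t) := fun t =>
    (A.toHomeomorph.isOpenMap _ Metric.isOpen_ball).measurableSet
  have hAb : ∀ {t : ℝ} {v : F}, ‖A.symm v‖ < t → v ∈ A '' Metric.ball 0 t := fun {t v} h =>
    ⟨A.symm v, by simpa using h, by simp⟩
  have hφW : (mulEquivHaarChar φ : ℝ≥0∞) * ν (Metric.ball 0 r) ≤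
      ν (A '' Metric.ball 0 (c * r)) := by
    rw [hν measurableSet_ball, hν (hAm _),
      ← mulEquivHaarChar_smul_preimage m φ (X := U ∩ f ⁻¹' (A '' Metric.ball 0 (c * r)))]
    change _ ≤ (mulEquivHaarChar φ : ℝ≥0∞) * _
    gcongr
    rintro x ⟨hxU, hx⟩
    rw [mem_preimage, mem_ball_zero_iff] at hx
    obtain ⟨⟨hxV, -⟩, hxφ⟩ := hsm x hxU (hx.trans hr1)
    refine ⟨hxφ, hAb ?_⟩
    have h1 := hφV x hxV
    have h2 := (hMle (f (φ x) - A (f x))).trans (mul_le_mul_of_nonneg_left h1 hM.le)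
    rw [map_sub, A.symm_apply_apply] at h2
    have h3 := norm_add_le (A.symm (f (φ x)) - f x) (f x)
    rw [sub_add_cancel] at h3
    have h4 : M * ((c - 1) / M * ‖f x‖) = (c - 1) * ‖f x‖ := by field_simp
    nlinarith
  have hup := measure_mul_ball_le ν vol (hAm (c * r)) (hAm (c ^ 2 * r)) (s := s)
    (β := ν (Metric.ball 0 (c * s))) (by
      rintro _ ⟨v, hv, rfl⟩ w hw
      rw [mem_ball_iff_norm] at hw
      rw [mem_ball_zero_iff] at hv
      refine hAb ?_
      have h2 := hMle (w - A v)
      rw [map_sub, A.symm_apply_apply] at h2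
      have h3 := norm_add_le (A.symm w - v) v
      rw [sub_add_cancel] at h3
      nlinarith) (by
      rintro _ ⟨v, hv, rfl⟩
      rw [mem_ball_zero_iff] at hv
      rw [hν measurableSet_ball, hν measurableSet_ball]
      refine (hball _ ((hNle v).trans_lt (lt_of_le_of_lt ?_ hr2)) s hsρ).1
      gcongr)
  have hlow := mul_le_measure_mul_ball ν vol (measurableSet_ball (x := (0 : F)) (ε := r))
    (measurableSet_ball (x := (0 : F)) (ε := r / c)) (s := c ^ 2 * s)
    (β := ν (Metric.ball 0 (c * s))) (by
      intro z hz
      rw [mem_ball_zero_iff] at hz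
      refine Metric.ball_subset_ball' ?_
      rw [dist_zero_right]
      linarith) (by
      intro z hz
      rw [mem_ball_zero_iff] at hz
      rw [hν measurableSet_ball, hν measurableSet_ball]
      have := (hball z (by linarith) (c ^ 2 * s) hs3).2
      have e : c ^ 2 * s / c = c * s := by field_simp
      rwa [e] at this)
  have hfin : ∀ t ≤ r, ν (Metric.ball 0 t) ≠ ⊤ := fun t ht => by
    rw [hν measurableSet_ball]
    refine ne_top_of_le_ne_top hC.measure_lt_top.ne (measure_mono ?_)
    rintro x ⟨hxU, hx⟩
    rw [mem_preimage, mem_ball_zero_iff] at hx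
    exact (hsm x hxU (by linarith)).1.2
  have hpos : ∀ t > 0, ν (Metric.ball 0 t) ≠ 0 := fun t ht => by
    rw [hν measurableSet_ball]
    refine (IsOpen.measure_pos m (hf.continuousOn.isOpen_inter_preimage hf.isOpen
      Metric.isOpen_ball) ⟨1, hf.one_mem, ?_⟩).ne'
    simpa [hf.map_one] using ht
  have hcs : c * s ≤ r := by
    have : 0 < r / c := by positivity
    nlinarith
  have hb : 0 < ν.real (Metric.ball 0 r) := ENNReal.toReal_pos (hpos r hr) (hfin r le_rfl)
  have hv : 0 < vol.real (Metric.ball 0 1) :=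
    ENNReal.toReal_pos (Metric.measure_ball_pos vol 0 one_pos).ne' measure_ball_lt_top.ne
  have hvol : ∀ t : ℝ, 0 < t → (vol (Metric.ball 0 t)).toReal =
      t ^ d * vol.real (Metric.ball 0 1) :=
    fun t ht => by
      rw [Measure.addHaar_ball_of_pos vol 0 ht, ENNReal.toReal_mul,
        ENNReal.toReal_ofReal (by positivity)]
      rfl
  have hAv : vol (A '' Metric.ball 0 (c ^ 2 * r)) =
      ENNReal.ofReal |LinearMap.det (A : F →ₗ[ℝ] F)| * vol (Metric.ball 0 (c ^ 2 * r)) :=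
    Measure.addHaar_image_continuousLinearEquiv vol A _
  have R1 : (mulEquivHaarChar φ : ℝ) * ν.real (Metric.ball 0 r) *
      (s ^ d * vol.real (Metric.ball 0 1)) ≤ |LinearMap.det (A : F →ₗ[ℝ] F)| *
        ((c ^ 2 * r) ^ d * vol.real (Metric.ball 0 1)) * ν.real (Metric.ball 0 (c * s)) := by
    have h1 := (mul_le_mul_left hφW (vol (Metric.ball 0 s))).trans hup
    rw [hAv] at h1
    have h2 := ENNReal.toReal_mono (ENNReal.mul_ne_top (ENNReal.mul_ne_top ENNReal.ofReal_ne_top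
      measure_ball_lt_top.ne) (hfin _ hcs)) h1
    simp only [ENNReal.toReal_mul, ENNReal.toReal_ofReal (abs_nonneg _)] at h2
    rw [hvol s hs, hvol _ (by positivity)] at h2
    exact h2
  have R2 : (r / c) ^ d * vol.real (Metric.ball 0 1) * ν.real (Metric.ball 0 (c * s)) ≤
      ν.real (Metric.ball 0 r) * ((c ^ 2 * s) ^ d * vol.real (Metric.ball 0 1)) := by
    have h2 := ENNReal.toReal_mono (ENNReal.mul_ne_top (hfin _ le_rfl) measure_ball_lt_top.ne) hlow
    simp only [ENNReal.toReal_mul] at h2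
    rw [hvol _ (by positivity), hvol _ (by positivity)] at h2
    exact h2
  set q : ℝ := NNReal.toReal (mulEquivHaarChar φ)
  set β := ν.real (Metric.ball 0 r)
  set v := vol.real (Metric.ball 0 1)
  have hpos' : 0 < β * s ^ d * v := by positivity
  refine le_of_mul_le_mul_right ?_ hpos'
  calc q * (β * s ^ d * v) = q * β * (s ^ d * v) := by ring
    _ ≤ _ := R1
    _ = |LinearMap.det (A : F →ₗ[ℝ] F)| * c ^ (3 * d) *
        ((r / c) ^ d * v * ν.real (Metric.ball 0 (c * s))) := by
        rw [div_pow, mul_pow, ← pow_mul, show 3 * d = 2 * d + d by ring, pow_add]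
        field_simp
    _ ≤ |LinearMap.det (A : F →ₗ[ℝ] F)| * c ^ (3 * d) * (β * ((c ^ 2 * s) ^ d * v)) := by gcongr
    _ = |LinearMap.det (A : F →ₗ[ℝ] F)| * c ^ (5 * d) * (β * s ^ d * v) := by
        rw [mul_pow, ← pow_mul, show 5 * d = 3 * d + 2 * d by ring, pow_add]
        ring

/-- An automorphism of `L` which in a local model is to first order the linear map `A` scales the
Haar measure by at most `|det A|`. -/
theorem IsLocalModel.mulEquivHaarChar_le [LocallyCompactSpace L]
    (hf : IsLocalModel f U) (m : Measure L) [m.IsHaarMeasure] [m.Regular] [SFinite m]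
    (φ : L ≃ₜ* L) (A : F ≃L[ℝ] F)
    (hφ : ∀ ε > 0, ∃ V ∈ 𝓝 (1 : L), ∀ x ∈ V, ‖f (φ x) - A (f x)‖ ≤ ε * ‖f x‖) :
    (mulEquivHaarChar φ : ℝ) ≤ |LinearMap.det (A : F →ₗ[ℝ] F)| := by
  have hlim : Tendsto (fun c : ℝ => |LinearMap.det (A : F →ₗ[ℝ] F)| *
      c ^ (5 * Module.finrank ℝ F)) (𝓝[>] 1) (𝓝 |LinearMap.det (A : F →ₗ[ℝ] F)|) := by
    have : Continuous fun c : ℝ => |LinearMap.det (A : F →ₗ[ℝ] F)| *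
      c ^ (5 * Module.finrank ℝ F) := by fun_prop
    simpa using (this.tendsto 1).mono_left nhdsWithin_le_nhds
  refine ge_of_tendsto hlim ?_
  filter_upwards [self_mem_nhdsWithin] with c hc
  exact hf.mulEquivHaarChar_le_mul m φ A hφ hc

end HaarModulus

/-! ### Powers of small elements are to first order multiples -/

section Powers

variable {G : Type*} [Group G] [TopologicalSpace G]
  {E : Type*} [NormedAddCommGroup E] {φ : G → E} {U : Set G}

theorem IsLocalModel.mem_nhds_one (h : IsLocalModel φ U) : U ∈ 𝓝 (1 : G) :=
  h.isOpen.mem_nhds h.one_mem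

theorem IsLocalModel.continuousAt (h : IsLocalModel φ U) {x : G} (hx : x ∈ U) :
    ContinuousAt φ x :=
  h.continuousOn.continuousAt (h.isOpen.mem_nhds hx)

theorem IsLocalModel.tendsto_one (h : IsLocalModel φ U) : Tendsto φ (𝓝 1) (𝓝 0) := by
  have := h.continuousAt h.one_mem
  rwa [ContinuousAt, h.map_one] at this

variable [IsTopologicalGroup G]

theorem IsLocalModel.inv_approx (h : IsLocalModel φ U) {ε : ℝ} (hε : 0 < ε) :
    ∃ V ∈ 𝓝 (1 : G), ∀ x ∈ V, x⁻¹ ∈ U ∧ ‖φ x⁻¹ + φ x‖ ≤ ε * ‖φ x‖ := by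
  -- The `1/2` gives `‖φ x⁻¹‖ ≤ 2 ‖φ x‖`, after which `ε/2` yields `ε`.
  obtain ⟨V, hV, hm⟩ := h.map_mul (min (1 / 2) (ε / 2)) (by positivity)
  have hinv : Tendsto (fun x : G => x⁻¹) (𝓝 1) (𝓝 1) := by
    simpa using (continuous_inv (G := G)).tendsto 1
  refine ⟨_, inter_mem hV (hinv (inter_mem hV h.mem_nhds_one)), fun x ⟨hx, hx'⟩ => ⟨hx'.2, ?_⟩⟩
  have h1 := hm x hx x⁻¹ hx'.1
  rw [mul_inv_cancel, h.map_one, zero_sub, ← neg_add', norm_neg, add_comm] at h1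
  have h2 := norm_sub_le (φ x⁻¹ + φ x) (φ x)
  rw [add_sub_cancel_right] at h2
  have h3 : min (1 / 2) (ε / 2) * ‖φ x⁻¹‖ ≤ 1 / 2 * ‖φ x⁻¹‖ := by gcongr; exact min_le_left _ _
  have h4 : min (1 / 2) (ε / 2) * ‖φ x⁻¹‖ ≤ ε / 2 * ‖φ x⁻¹‖ := by gcongr; exact min_le_right _ _
  nlinarith

variable [NormedSpace ℝ E]

/-- Each new factor costs `ε ‖φ x‖`, and `ε ≤ 1` keeps `‖φ (x ^ k)‖` below `2 k ‖φ x‖`. So the range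
depends only on `k ‖φ x‖`, uniformly as `x → 1` and `k → ∞`. -/
theorem IsLocalModel.pow_approx (h : IsLocalModel φ U) {ε : ℝ} (hε : 0 < ε) (hε1 : ε ≤ 1) :
    ∃ ρ > 0, ∀ x ∈ U, ∀ k : ℕ, k * ‖φ x‖ ≤ ρ →
      x ^ k ∈ U ∧ ‖φ (x ^ k) - (k : ℝ) • φ x‖ ≤ ε * (k * ‖φ x‖) := by
  obtain ⟨V, hV, hm⟩ := h.map_mul ε hε
  have hmu : Tendsto (fun x : G × G => x.1 * x.2) (𝓝 (1, 1)) (𝓝 1) := by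
    have : Continuous fun x : G × G => x.1 * x.2 := by fun_prop
    simpa using this.tendsto (1, 1)
  have hpre := mem_map.1 (hmu h.mem_nhds_one)
  rw [nhds_prod_eq, mem_prod_iff] at hpre
  obtain ⟨S, hS, S', hS', hSS⟩ := hpre
  obtain ⟨ρ, hρ, hsm⟩ := h.mem_of_small _ (inter_mem hV (inter_mem hS hS'))
  refine ⟨ρ / 4, by positivity, fun x hx k => ?_⟩
  induction k with
  | zero => intro _; simp [h.one_mem, h.map_one]
  | succ k ih =>
    intro hk
    push_cast at hk
    have hn := norm_nonneg (φ x)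
    have hkn : 0 ≤ k * ‖φ x‖ := by positivity
    obtain ⟨hU, hle⟩ := ih (by linarith)
    have h1 : ‖φ (x ^ k)‖ < ρ := by
      have := norm_add_le (φ (x ^ k) - (k : ℝ) • φ x) ((k : ℝ) • φ x)
      rw [sub_add_cancel, norm_smul, Real.norm_natCast] at this
      nlinarith
    have hxk := hsm _ hU h1
    have hx1 := hsm x hx (by linarith)
    have h2 := hm _ hxk.1 x hx1.1
    rw [← pow_succ] at h2
    refine ⟨?_, ?_⟩
    · rw [pow_succ]; exact hSS (mk_mem_prod hxk.2.1 hx1.2.2)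
    · have h3 := norm_add_le (φ (x ^ (k + 1)) - φ (x ^ k) - φ x) (φ (x ^ k) - (k : ℝ) • φ x)
      have e : φ (x ^ (k + 1)) - φ (x ^ k) - φ x + (φ (x ^ k) - (k : ℝ) • φ x) =
          φ (x ^ (k + 1)) - ((k + 1 : ℕ) : ℝ) • φ x := by
        push_cast; rw [add_smul, one_smul]; abel
      rw [e] at h3
      push_cast at h3 ⊢
      nlinarith

theorem IsLocalModel.zpow_approx (h : IsLocalModel φ U) {ε : ℝ} (hε : 0 < ε) :
    ∃ ρ > 0, ∀ x ∈ U, ∀ k : ℤ, |(k : ℝ)| * ‖φ x‖ ≤ ρ →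
      x ^ k ∈ U ∧ ‖φ (x ^ k) - (k : ℝ) • φ x‖ ≤ ε * (|(k : ℝ)| * ‖φ x‖) := by
  obtain ⟨ρ, hρ, hp⟩ := h.pow_approx (ε := min 1 (ε / 3)) (by positivity) (min_le_left _ _)
  obtain ⟨V, hV, hi⟩ := h.inv_approx (ε := ε / 3) (by positivity)
  obtain ⟨ρ', hρ', hsm⟩ := h.mem_of_small V hV
  refine ⟨min ρ (ρ' / 4), by positivity, fun x hx k hk => ?_⟩
  have hk1 := hk.trans (min_le_left _ _)
  have hk2 := hk.trans (min_le_right _ _)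
  obtain ⟨n, rfl | rfl⟩ := k.eq_nat_or_neg
  · simp only [Int.cast_natCast, Nat.abs_cast, zpow_natCast] at hk1 ⊢
    obtain ⟨h1, h2⟩ := hp x hx n hk1
    refine ⟨h1, h2.trans ?_⟩
    gcongr
    exact (min_le_right _ _).trans (by linarith)
  · simp only [Int.cast_neg, Int.cast_natCast, abs_neg, Nat.abs_cast, zpow_neg, zpow_natCast]
      at hk1 hk2 ⊢
    obtain ⟨h1, h2⟩ := hp x hx n hk1
    set A := (n : ℝ) * ‖φ x‖
    have hA : 0 ≤ A := by positivity
    have h3 : ‖φ (x ^ n)‖ ≤ 2 * A := by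
      have := norm_add_le (φ (x ^ n) - (n : ℝ) • φ x) ((n : ℝ) • φ x)
      rw [sub_add_cancel, norm_smul, Real.norm_natCast] at this
      have h4 : min 1 (ε / 3) * A ≤ 1 * A := by gcongr; exact min_le_left _ _
      linarith
    obtain ⟨h4, h5⟩ := hi _ (hsm _ h1 (by linarith))
    refine ⟨h4, ?_⟩
    have h6 := norm_sub_le (φ (x ^ n)⁻¹ + φ (x ^ n)) (φ (x ^ n) - (n : ℝ) • φ x)
    have e : φ (x ^ n)⁻¹ + φ (x ^ n) - (φ (x ^ n) - (n : ℝ) • φ x) =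
        φ (x ^ n)⁻¹ - (-(n : ℝ)) • φ x := by rw [neg_smul]; abel
    rw [e] at h6
    have h7 : min 1 (ε / 3) * A ≤ ε / 3 * A := by gcongr; exact min_le_right _ _
    nlinarith

end Powers

/-! ### One-parameter subgroups as limits of powers -/

section OneParameter

theorem abs_floor_div_mul_sub_le (t : ℝ) {e : ℝ} (he : 0 < e) :
    |(⌊t / e⌋ : ℝ) * e - t| ≤ e := by
  have a1 := Int.floor_le (t / e)
  have a2 := Int.lt_floor_add_one (t / e)
  rw [le_div_iff₀ he] at a1
  rw [div_lt_iff₀ he] at a2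
  rw [abs_le]
  constructor <;> linarith

theorem abs_floor_div_mul_le (t : ℝ) {e : ℝ} (he : 0 < e) :
    |(⌊t / e⌋ : ℝ)| * e ≤ |t| + e := by
  have h1 := abs_floor_div_mul_sub_le t he
  have h2 := abs_add_le ((⌊t / e⌋ : ℝ) * e - t) t
  rw [sub_add_cancel, abs_mul, abs_of_pos he] at h2
  linarith

variable {G : Type*} [Group G] [TopologicalSpace G] [IsTopologicalGroup G]
  [LocallyCompactSpace G] {E : Type*} [NormedAddCommGroup E] [NormedSpace ℝ E] {φ : G → E}
  {U : Set G}

/-- The powers stay in a compact set, where the ultrafilter converges. For large `t` the exponent is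
divided by a fixed `n`: the quotient power stays in a small compact `C`, and the remainder is one of
finitely many powers, all near `1`. -/
theorem IsLocalModel.exists_limit_zpow (h : IsLocalModel φ U) {𝒰 : Ultrafilter G}
    (h1 : (𝒰 : Filter G) ≤ 𝓝 1) (h0 : ∀ᶠ x in (𝒰 : Filter G), φ x ≠ 0) (t : ℝ) :
    ∃ g, Tendsto (fun x => x ^ ⌊t / ‖φ x‖⌋) 𝒰 (𝓝 g) := by
  obtain ⟨ρ, hρ, hz⟩ := h.zpow_approx one_pos
  obtain ⟨C, hC, hCn⟩ := exists_compact_mem_nhds (1 : G)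
  obtain ⟨ρ', hρ', hsm⟩ := h.mem_of_small C hCn
  obtain ⟨n, hn⟩ := exists_nat_gt (max 1 ((|t| + 2) / min (ρ / 2) (ρ' / 8)))
  have hn1 : (1 : ℝ) < n := (le_max_left _ _).trans_lt hn
  have hn0 : (0 : ℝ) < n := by linarith
  have hnt : |t| + 2 < n * min (ρ / 2) (ρ' / 8) := by
    rw [← div_lt_iff₀ (by positivity)]; exact (le_max_right _ _).trans_lt hn
  have hsmall : ∀ᶠ x in (𝒰 : Filter G), ‖φ x‖ < min 1 (min (ρ / 2) (ρ' / 8)) := by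
    have := (h.tendsto_one.mono_left h1).norm
    rw [norm_zero] at this
    exact this.eventually_lt_const (by positivity)
  have hpows : ∀ᶠ x in (𝒰 : Filter G), ∀ r ∈ Finset.range n, x ^ r ∈ C := by
    rw [Filter.eventually_all_finset]
    intro r _
    have : Tendsto (fun x : G => x ^ r) (𝓝 1) (𝓝 1) := by
      simpa using (continuous_pow (M := G) r).tendsto 1
    exact h1 (this hCn)
  have hK : IsCompact (((fun x : G => x ^ n) '' C) * C) := (hC.image (continuous_pow n)).mul hC
  have hmem : ∀ᶠ x in (𝒰 : Filter G), x ^ ⌊t / ‖φ x‖⌋ ∈ ((fun x : G => x ^ n) '' C) * C := by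
    filter_upwards [h0, hsmall, hpows, h1 h.mem_nhds_one] with x hx0 hxs hxp hxU
    set e := ‖φ x‖
    have he : 0 < e := norm_pos_iff.2 hx0
    have he1 : e < 1 := hxs.trans_le (min_le_left _ _)
    have he2 : e < min (ρ / 2) (ρ' / 8) := hxs.trans_le (min_le_right _ _)
    set k := ⌊t / e⌋
    have hk : |(k : ℝ)| * e ≤ |t| + 1 := by
      exact (abs_floor_div_mul_le t he).trans (by linarith)
    have hnz : (0 : ℤ) < n := by exact_mod_cast hn0
    have hq : |((k / n : ℤ) : ℝ)| * e ≤ min ρ (ρ' / 4) := by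
      have d1 : ((n : ℤ) : ℝ) * ((k / n : ℤ) : ℝ) = k - ((k % n : ℤ) : ℝ) := by
        have := Int.mul_ediv_add_emod k n
        rw [eq_sub_iff_add_eq]; exact_mod_cast this
      have d2 : (0 : ℝ) ≤ ((k % n : ℤ) : ℝ) := by exact_mod_cast Int.emod_nonneg k hnz.ne'
      have d3 : ((k % n : ℤ) : ℝ) ≤ n := by exact_mod_cast (Int.emod_lt_of_pos k hnz).le
      have d4 : (n : ℝ) * |((k / n : ℤ) : ℝ)| ≤ |(k : ℝ)| + n := by
        calc (n : ℝ) * |((k / n : ℤ) : ℝ)| = |((n : ℤ) : ℝ) * ((k / n : ℤ) : ℝ)| := by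
              rw [abs_mul]; simp
          _ = |(k : ℝ) - ((k % n : ℤ) : ℝ)| := by rw [d1]
          _ ≤ |(k : ℝ)| + |((k % n : ℤ) : ℝ)| := abs_sub _ _
          _ ≤ |(k : ℝ)| + n := by rw [abs_of_nonneg d2]; linarith
      have d5 : (n : ℝ) * (|((k / n : ℤ) : ℝ)| * e) ≤ n * (2 * min (ρ / 2) (ρ' / 8)) := by
        nlinarith
      have d6 := le_of_mul_le_mul_left d5 hn0
      refine d6.trans (le_min ?_ ?_)
      · linarith [min_le_left (ρ / 2) (ρ' / 8)]
      · linarith [min_le_right (ρ / 2) (ρ' / 8)]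
    obtain ⟨hU', hle⟩ := hz x hxU (k / n) (hq.trans (min_le_left _ _))
    have hxC : x ^ (k / n : ℤ) ∈ C := by
      refine hsm _ hU' ?_
      have := norm_add_le (φ (x ^ (k / n : ℤ)) - ((k / n : ℤ) : ℝ) • φ x)
        (((k / n : ℤ) : ℝ) • φ x)
      rw [sub_add_cancel, norm_smul, Real.norm_eq_abs] at this
      have := hq.trans (min_le_right _ _)
      linarith
    refine ⟨(x ^ (k / n : ℤ)) ^ n, ⟨_, hxC, rfl⟩, x ^ (k % n).toNat, hxp _ ?_, ?_⟩
    · rw [Finset.mem_range]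
      have := Int.emod_lt_of_pos k hnz
      have := Int.emod_nonneg k hnz.ne'
      omega
    · change (x ^ (k / n : ℤ)) ^ n * x ^ (k % n).toNat = x ^ k
      rw [← zpow_natCast, ← zpow_natCast, Int.toNat_of_nonneg (Int.emod_nonneg k hnz.ne'),
        ← zpow_mul, ← zpow_add, mul_comm, Int.mul_ediv_add_emod]
  obtain ⟨g, -, hg⟩ := hK.ultrafilter_le_nhds' (𝒰.map fun x => x ^ ⌊t / ‖φ x‖⌋) hmem
  exact ⟨g, hg⟩

variable [T2Space G]

/-- Directions in which elements of a closed subgroup accumulate at the identity are velocities of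
one-parameter subgroups. -/
theorem IsLocalModel.exists_oneParam (h : IsLocalModel φ U) {L : Subgroup G}
    (hL : IsClosed (L : Set G)) {𝒰 : Ultrafilter G} (h1 : (𝒰 : Filter G) ≤ 𝓝 1)
    (h0 : ∀ᶠ x in (𝒰 : Filter G), φ x ≠ 0) (h𝒰L : ∀ᶠ x in (𝒰 : Filter G), x ∈ L) {X : E}
    (hX : Tendsto (fun x => ‖φ x‖⁻¹ • φ x) 𝒰 (𝓝 X)) :
    ∃ γ : ℝ → G, (∀ s t, γ (s + t) = γ s * γ t) ∧ (∀ t, γ t ∈ L) ∧ ContinuousAt γ 0 ∧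
      HasDerivAt (fun t => φ (γ t)) X 0 := by
  choose γ hγ using h.exists_limit_zpow h1 h0
  have hhom : ∀ s t, γ (s + t) = γ s * γ t := by
    intro s t
    refine tendsto_nhds_unique (hγ (s + t)) ?_
    have hδ : Tendsto (fun x : G => x ^ (⌊(s + t) / ‖φ x‖⌋ - ⌊s / ‖φ x‖⌋ - ⌊t / ‖φ x‖⌋))
        𝒰 (𝓝 1) := by
      refine fun V hV => mem_map.2 ?_
      filter_upwards [h1 hV] with x hx
      have b1 := Int.le_floor_add (s / ‖φ x‖) (t / ‖φ x‖)
      have b2 := Int.le_floor_add_floor (s / ‖φ x‖) (t / ‖φ x‖)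
      rw [← add_div] at b1 b2
      obtain h' | h' : ⌊(s + t) / ‖φ x‖⌋ - ⌊s / ‖φ x‖⌋ - ⌊t / ‖φ x‖⌋ = 0 ∨
          ⌊(s + t) / ‖φ x‖⌋ - ⌊s / ‖φ x‖⌋ - ⌊t / ‖φ x‖⌋ = 1 := by omega
      · rw [mem_preimage, h', zpow_zero]; exact mem_of_mem_nhds hV
      · rw [mem_preimage, h', zpow_one]; exact hx
    have := ((hγ s).mul (hγ t)).mul hδ
    rw [mul_one] at this
    refine this.congr fun x => ?_
    rw [← zpow_add, ← zpow_add]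
    congr 1
    ring
  have hγ0 : γ 0 = 1 := by simpa using hhom 0 0
  have key : ∀ ε > 0, ∀ V ∈ 𝓝 (1 : G), ∃ ρ > 0, ∀ t, |t| < ρ →
      γ t ∈ V ∧ ‖φ (γ t) - t • X‖ ≤ ε * |t| := by
    intro ε hε V hV
    obtain ⟨C, hCn, hCV, hC⟩ := local_compact_nhds (inter_mem hV h.mem_nhds_one)
    obtain ⟨ρ₁, hρ₁, hsm⟩ := h.mem_of_small C hCn
    obtain ⟨ρ₂, hρ₂, hz⟩ := h.zpow_approx (ε := min 1 ε) (by positivity)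
    refine ⟨min (ρ₁ / 4) (ρ₂ / 2), by positivity, fun t ht => ?_⟩
    have ht1 := ht.trans_le (min_le_left _ _)
    have ht2 := ht.trans_le (min_le_right _ _)
    have hnorm : Tendsto (fun x => ‖φ x‖) 𝒰 (𝓝 0) := by
      simpa using (h.tendsto_one.mono_left h1).norm
    have hest : ∀ᶠ x in (𝒰 : Filter G), x ^ ⌊t / ‖φ x‖⌋ ∈ C ∧
        ‖φ (x ^ ⌊t / ‖φ x‖⌋) - (⌊t / ‖φ x‖⌋ : ℝ) • φ x‖ ≤ ε * (|t| + ‖φ x‖) := by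
      filter_upwards [h0, h1 h.mem_nhds_one,
        hnorm.eventually_lt_const (show 0 < min (ρ₁ / 4) (ρ₂ / 2) by positivity)] with x hx0 hxU hxs
      have he : 0 < ‖φ x‖ := norm_pos_iff.2 hx0
      have hxs1 := hxs.trans_le (min_le_left _ _)
      have hxs2 := hxs.trans_le (min_le_right _ _)
      have hk := abs_floor_div_mul_le t he
      obtain ⟨hU', hle⟩ := hz x hxU _ (hk.trans (by linarith))
      have hA : 0 ≤ |(⌊t / ‖φ x‖⌋ : ℝ)| * ‖φ x‖ := by positivity
      have m1 : min 1 ε * (|(⌊t / ‖φ x‖⌋ : ℝ)| * ‖φ x‖) ≤ 1 * (|t| + ‖φ x‖) := by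
        gcongr
        exact min_le_left _ _
      have m2 : min 1 ε * (|(⌊t / ‖φ x‖⌋ : ℝ)| * ‖φ x‖) ≤ ε * (|t| + ‖φ x‖) := by
        gcongr
        exact min_le_right _ _
      refine ⟨hsm _ hU' ?_, hle.trans m2⟩
      have := norm_add_le (φ (x ^ ⌊t / ‖φ x‖⌋) - (⌊t / ‖φ x‖⌋ : ℝ) • φ x)
        ((⌊t / ‖φ x‖⌋ : ℝ) • φ x)
      rw [sub_add_cancel, norm_smul, Real.norm_eq_abs] at this
      linarith
    have hγC : γ t ∈ C := hC.isClosed.mem_of_tendsto (hγ t) (hest.mono fun x hx => hx.1)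
    refine ⟨(hCV hγC).1, ?_⟩
    have l1 : Tendsto (fun x => φ (x ^ ⌊t / ‖φ x‖⌋)) 𝒰 (𝓝 (φ (γ t))) :=
      (h.continuousAt (hCV hγC).2).tendsto.comp (hγ t)
    have l2 : Tendsto (fun x => (⌊t / ‖φ x‖⌋ : ℝ) * ‖φ x‖) 𝒰 (𝓝 t) := by
      rw [tendsto_iff_norm_sub_tendsto_zero]
      refine squeeze_zero' (Eventually.of_forall fun _ => norm_nonneg _) ?_ hnorm
      filter_upwards [h0] with x hx0
      exact abs_floor_div_mul_sub_le t (norm_pos_iff.2 hx0)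
    have l3 : Tendsto (fun x => (⌊t / ‖φ x‖⌋ : ℝ) • φ x) 𝒰 (𝓝 (t • X)) := by
      refine (l2.smul hX).congr' ?_
      filter_upwards [h0] with x hx0
      rw [smul_smul, mul_assoc, mul_inv_cancel₀ (norm_ne_zero_iff.2 hx0), mul_one]
    have l4 : Tendsto (fun x => ε * (|t| + ‖φ x‖)) 𝒰 (𝓝 (ε * |t|)) := by
      simpa using (hnorm.const_add |t|).const_mul ε
    exact le_of_tendsto_of_tendsto (l1.sub l3).norm l4 (hest.mono fun x hx => hx.2)
  refine ⟨γ, hhom, fun t => hL.mem_of_tendsto (hγ t) ?_, ?_, ?_⟩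
  · filter_upwards [h𝒰L] with x hx using zpow_mem hx _
  · intro V hV
    rw [hγ0] at hV
    obtain ⟨ρ, hρ, hk⟩ := key 1 one_pos V hV
    rw [mem_map]
    filter_upwards [Metric.ball_mem_nhds (0 : ℝ) hρ] with t ht
    exact (hk t (by simpa using ht)).1
  · rw [hasDerivAt_iff_isLittleO, Asymptotics.isLittleO_iff]
    intro ε hε
    obtain ⟨ρ, hρ, hk⟩ := key ε hε univ univ_mem
    filter_upwards [Metric.ball_mem_nhds (0 : ℝ) hρ] with t ht
    have := (hk t (by simpa using ht)).2
    simpa [hγ0, h.map_one] using this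

/-- If `P` fixes the velocities of all one-parameter subgroups of a closed subgroup `L`, then it
fixes the elements of `L` near the identity to first order. -/
theorem IsLocalModel.norm_sub_proj_le [FiniteDimensional ℝ E] (h : IsLocalModel φ U)
    {L : Subgroup G} (hL : IsClosed (L : Set G)) (P : E →L[ℝ] E)
    (hP : ∀ (γ : ℝ → G) (X : E), (∀ s t, γ (s + t) = γ s * γ t) → (∀ t, γ t ∈ L) →
      ContinuousAt γ 0 → HasDerivAt (fun t => φ (γ t)) X 0 → P X = X) {ε : ℝ} (hε : 0 < ε) :
    ∃ V ∈ 𝓝 (1 : G), ∀ x ∈ V, x ∈ L → ‖φ x - P (φ x)‖ ≤ ε * ‖φ x‖ := by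
  -- Along an ultrafilter of counterexamples in `L`, the directions `φ x / ‖φ x‖` converge to some
  -- `X` by compactness. `X` is a velocity, so `P X = X`, yet the violated inequality forces `‖X - P
  -- X‖ ≥ ε`.
  by_contra hcon
  push Not at hcon
  have hne : (𝓝 (1 : G) ⊓ 𝓟 {x | x ∈ L ∧ ε * ‖φ x‖ < ‖φ x - P (φ x)‖}).NeBot := by
    rw [← frequently_mem_iff_neBot, frequently_iff]
    intro V hV
    obtain ⟨x, hx, hxL, hx'⟩ := hcon V hV
    exact ⟨x, hx, hxL, hx'⟩
  let 𝒰 := Ultrafilter.of (𝓝 (1 : G) ⊓ 𝓟 {x | x ∈ L ∧ ε * ‖φ x‖ < ‖φ x - P (φ x)‖})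
  have h𝒰 : (𝒰 : Filter G) ≤ _ := Ultrafilter.of_le _
  have h1 : (𝒰 : Filter G) ≤ 𝓝 1 := h𝒰.trans inf_le_left
  have hS : ∀ᶠ x in (𝒰 : Filter G), x ∈ L ∧ ε * ‖φ x‖ < ‖φ x - P (φ x)‖ :=
    (h𝒰.trans inf_le_right) (mem_principal_self _)
  have h0 : ∀ᶠ x in (𝒰 : Filter G), φ x ≠ 0 := by
    filter_upwards [hS] with x hx hx0
    simp [hx0] at hx
  have : ProperSpace E := FiniteDimensional.proper_real E
  obtain ⟨X, -, hX⟩ := (isCompact_closedBall (0 : E) 1).ultrafilter_le_nhds'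
    (𝒰.map fun x => ‖φ x‖⁻¹ • φ x) (by
      change ∀ᶠ x in (𝒰 : Filter G), ‖φ x‖⁻¹ • φ x ∈ Metric.closedBall (0 : E) 1
      filter_upwards [h0] with x hx0
      rw [mem_closedBall_zero_iff, norm_smul, norm_inv, norm_norm,
        inv_mul_cancel₀ (norm_ne_zero_iff.2 hx0)])
  have hX' : Tendsto (fun x => ‖φ x‖⁻¹ • φ x) 𝒰 (𝓝 X) := hX
  obtain ⟨γ, g1, g2, g3, g4⟩ := h.exists_oneParam hL h1 h0 (hS.mono fun x hx => hx.1) hX'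
  have hPX := hP γ X g1 g2 g3 g4
  have hlim := (hX'.sub ((P.continuous.tendsto X).comp hX')).norm
  rw [hPX, sub_self, norm_zero] at hlim
  have : ε ≤ 0 := by
    refine ge_of_tendsto hlim ?_
    filter_upwards [hS, h0] with x hx hx0
    have hp := norm_pos_iff.2 hx0
    rw [Function.comp_apply, map_smul, ← smul_sub, norm_smul, norm_inv, norm_norm,
      ← div_eq_inv_mul, le_div_iff₀ hp]
    exact hx.2.le
  linarith

end OneParameter

/-! ### A closed subgroup has a first-order model in its Lie algebra -/

section ClosedSubgroup

variable {G : Type*} [Group G] [TopologicalSpace G]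
  {E : Type*} [NormedAddCommGroup E] [NormedSpace ℝ E] {φ : G → E} {U : Set G}

/-- `v` is the velocity at the identity of a curve in `L`. -/
def IsTangent (φ : G → E) (L : Subgroup G) (v : E) : Prop :=
  ∃ γ : ℝ → L, Tendsto γ (𝓝 0) (𝓝 1) ∧ γ 0 = 1 ∧ HasDerivAt (fun t => φ (γ t)) v 0

theorem IsLocalModel.isTangent_zero (h : IsLocalModel φ U) (L : Subgroup G) :
    IsTangent φ L 0 :=
  ⟨fun _ => 1, tendsto_const_nhds, rfl, by simpa [h.map_one] using hasDerivAt_const (0 : ℝ) (0 : E)⟩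

theorem IsTangent.smul {L : Subgroup G} {v : E} (hv : IsTangent φ L v) (c : ℝ) :
    IsTangent φ L (c • v) := by
  obtain ⟨γ, h1, h2, h3⟩ := hv
  have hc : HasDerivAt (fun t : ℝ => c * t) c 0 := by
    simpa using (hasDerivAt_id (0 : ℝ)).const_mul c
  refine ⟨fun t => γ (c * t), ?_, by simpa using h2, ?_⟩
  · have : Tendsto (fun t : ℝ => c * t) (𝓝 0) (𝓝 0) := by simpa using hc.continuousAt.tendsto
    exact h1.comp this
  · have h3' : HasDerivAt (fun t => φ (γ t)) v (c * 0) := by simpa using h3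
    exact HasDerivAt.scomp (0 : ℝ) h3' hc

variable [IsTopologicalGroup G]

/-- The product of two curves realizes the sum of their velocities, although it need not be a
one-parameter subgroup. This handles `lieAlg`, which is defined as a span. -/
theorem IsLocalModel.isTangent_add (h : IsLocalModel φ U) {L : Subgroup G} {v w : E}
    (hv : IsTangent φ L v) (hw : IsTangent φ L w) : IsTangent φ L (v + w) := by
  obtain ⟨γ, h1, h2, h3⟩ := hv
  obtain ⟨δ, k1, k2, k3⟩ := hw
  refine ⟨fun t => γ t * δ t, by simpa using h1.mul k1, by simp [h2, k2], ?_⟩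
  have hval : ∀ {α : ℝ → L}, Tendsto α (𝓝 0) (𝓝 1) → ∀ V ∈ 𝓝 (1 : G), ∀ᶠ t in 𝓝 0,
      (α t : G) ∈ V := fun hα V hV =>
    hα (continuous_subtype_val.continuousAt (x := (1 : L)) (by simpa using hV))
  have hdiff : HasDerivAt (fun t => φ (γ t * δ t) - φ (γ t) - φ (δ t)) 0 0 := by
    have k4 : (fun t => φ (δ t)) =O[𝓝 0] fun t : ℝ => t := by
      simpa [k2, h.map_one] using k3.isBigO_sub
    rw [hasDerivAt_iff_isLittleO]
    have : (fun t => φ (γ t * δ t) - φ (γ t) - φ (δ t)) =o[𝓝 0] fun t => φ (δ t) := by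
      rw [Asymptotics.isLittleO_iff]
      intro ε hε
      obtain ⟨V, hV, hm⟩ := h.map_mul ε hε
      filter_upwards [hval h1 V hV, hval k1 V hV] with t ht ht'
      exact hm _ ht _ ht'
    simpa [h2, k2, h.map_one] using this.trans_isBigO k4
  have := (hdiff.add h3).add k3
  rw [zero_add] at this
  refine this.congr_of_eventuallyEq (Eventually.of_forall fun t => ?_)
  simp only [Pi.add_apply, Subgroup.coe_mul]
  abel

theorem IsLocalModel.isTangent_span (h : IsLocalModel φ U) {L : Subgroup G} {s : Set E}
    (hs : ∀ v ∈ s, IsTangent φ L v) {v : E} (hv : v ∈ Submodule.span ℝ s) : IsTangent φ L v := by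
  induction hv using Submodule.span_induction with
  | mem x hx => exact hs x hx
  | zero => exact h.isTangent_zero L
  | add x y _ _ hx hy => exact h.isTangent_add hx hy
  | smul c x _ hx => exact hx.smul c

variable [LocallyCompactSpace G] [T2Space G] [FiniteDimensional ℝ E]

/-- A nearest point argument: a map that is almost additive near the identity and attains all
directions there is locally onto. -/
theorem image_mem_nhds_zero {L : Type*} [Group L] [TopologicalSpace L] [IsTopologicalGroup L]
    [LocallyCompactSpace L] {F : Type*} [NormedAddCommGroup F] [NormedSpace ℝ F] {f : L → F}
    {U : Set L} (hU : IsOpen U) (h1 : (1 : L) ∈ U) (hf1 : f 1 = 0) (hf : ContinuousOn f U)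
    (hsmall : ∀ V ∈ 𝓝 (1 : L), ∃ ρ > 0, ∀ x ∈ U, ‖f x‖ < ρ → x ∈ V)
    (hmul : ∀ ε > 0, ∃ V ∈ 𝓝 (1 : L), ∀ x ∈ V, ∀ z ∈ V, ‖f (x * z) - f x - f z‖ ≤ ε * ‖f z‖)
    (htan : ∀ v : F, ∃ γ : ℝ → L, Tendsto γ (𝓝 0) (𝓝 1) ∧ γ 0 = 1 ∧
      HasDerivAt (fun t => f (γ t)) v 0) {V : Set L} (hV : V ∈ 𝓝 1) : f '' V ∈ 𝓝 (0 : F) := by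
  obtain ⟨W, hW, hadd⟩ := hmul (1 / 4) (by norm_num)
  obtain ⟨C, hCn, hCV, hC⟩ := local_compact_nhds (inter_mem (inter_mem hV (hU.mem_nhds h1)) hW)
  obtain ⟨ρ, hρ, hsm⟩ := hsmall _ (interior_mem_nhds.2 hCn)
  refine Metric.mem_nhds_iff.2 ⟨ρ / 2, by positivity, fun z hz => ?_⟩
  rw [mem_ball_zero_iff] at hz
  have h1C : (1 : L) ∈ C := mem_of_mem_nhds hCn
  obtain ⟨x, hxC, hmin⟩ := hC.exists_isMinOn ⟨1, h1C⟩
    (f := fun x => ‖f x - z‖) ((hf.mono fun x hx => (hCV hx).1.2).sub continuousOn_const).norm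
  have hx1 : ‖f x - z‖ ≤ ‖z‖ := by simpa [hf1] using hmin h1C
  have hxint : x ∈ interior C := by
    refine hsm x (hCV hxC).1.2 ?_
    have := norm_add_le (f x - z) z
    rw [sub_add_cancel] at this
    linarith
  by_cases hxz : f x = z
  · exact ⟨x, (hCV hxC).1.1, hxz⟩
  exfalso
  set v := z - f x
  have hv : 0 < ‖v‖ := norm_pos_iff.2 (sub_ne_zero.2 (Ne.symm hxz))
  -- Moving the nearest point `x` along a curve with velocity `z - f x` gains `t ‖v‖` and loses at
  -- most `(1/4 + 5/16) t ‖v‖`, contradicting minimality.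
  obtain ⟨γ, g1, g2, g3⟩ := htan v
  rw [hasDerivAt_iff_isLittleO, Asymptotics.isLittleO_iff] at g3
  have e1 := g3 (c := ‖v‖ / 4) (by positivity)
  have e2 : ∀ᶠ t in 𝓝 (0 : ℝ), x * γ t ∈ C := by
    have : Tendsto (fun t => x * γ t) (𝓝 0) (𝓝 x) := by simpa using g1.const_mul x
    exact this (mem_interior_iff_mem_nhds.1 hxint)
  have e3 : ∀ᶠ t in 𝓝 (0 : ℝ), γ t ∈ W := g1 hW
  have e4 : ∀ᶠ t in 𝓝 (0 : ℝ), t < 1 := eventually_lt_nhds one_pos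
  have hall := ((e1.and (e2.and (e3.and e4))).filter_mono nhdsWithin_le_nhds).and
    (self_mem_nhdsWithin (a := (0 : ℝ)) (s := Ioi 0))
  obtain ⟨t, ⟨f1, f2, f3, f4⟩, ht⟩ := hall.exists
  have ht : 0 < t := ht
  simp only [g2, hf1, sub_zero, Real.norm_eq_abs, abs_of_pos ht] at f1
  have m1 : ‖f x - z‖ ≤ ‖f (x * γ t) - z‖ := hmin f2
  have hvz : ‖f x - z‖ = ‖v‖ := by rw [norm_sub_rev]
  have m2 := hadd x (hCV hxC).2 (γ t) f3
  have m3 : ‖f (γ t)‖ ≤ t * ‖v‖ + ‖v‖ / 4 * t := by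
    have := norm_add_le (f (γ t) - t • v) (t • v)
    rw [sub_add_cancel, norm_smul, Real.norm_eq_abs, abs_of_pos ht] at this
    linarith
  have m4 : ‖f (x * γ t) - z‖ ≤ 1 / 4 * ‖f (γ t)‖ + ‖v‖ / 4 * t + (1 - t) * ‖v‖ := by
    have e : f (x * γ t) - z = (f (x * γ t) - f x - f (γ t)) + (f (γ t) - t • v) +
        (-((1 - t) • v)) := by
      rw [sub_smul, one_smul]; simp only [v]; abel
    rw [e]
    refine (norm_add₃_le).trans ?_
    rw [norm_neg, norm_smul, Real.norm_eq_abs, abs_of_pos (by linarith : (0 : ℝ) < 1 - t)]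
    linarith
  nlinarith [mul_pos ht hv]

/-- A closed subgroup has a local model with values in the space `l` of its tangent vectors. -/
theorem IsLocalModel.subgroup (h : IsLocalModel φ U) {L : Subgroup G}
    (hL : IsClosed (L : Set G)) (l : Submodule ℝ E) (P : E →L[ℝ] l) (hPl : ∀ v : l, P v = v)
    (hl : ∀ (γ : ℝ → G) (X : E), (∀ s t, γ (s + t) = γ s * γ t) → (∀ t, γ t ∈ L) →
      ContinuousAt γ 0 → HasDerivAt (fun t => φ (γ t)) X 0 → X ∈ l)
    (htan : ∀ v ∈ l, IsTangent φ L v) :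
    ∃ V : Set L, IsLocalModel (fun x : L => P (φ x)) V := by
  have hcone : ∀ ε > 0, ∃ V ∈ 𝓝 (1 : G), ∀ x ∈ V, x ∈ L → ‖φ x - P (φ x)‖ ≤ ε * ‖φ x‖ :=
    fun ε hε => h.norm_sub_proj_le hL (l.subtypeL.comp P) (fun γ X g1 g2 g3 g4 => by
      have := hPl ⟨X, hl γ X g1 g2 g3 g4⟩
      exact congrArg Subtype.val this) hε
  -- On `L` near the identity `φ` and `P ∘ φ` then have comparable norms, so the estimates of the
  -- model of `G` carry over.
  obtain ⟨V₀, hV₀, hle⟩ := hcone (1 / 2) (by norm_num)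
  have hle' : ∀ x ∈ V₀, x ∈ L → ‖φ x‖ ≤ 2 * ‖P (φ x)‖ := fun x hx hxL => by
    have h1 := hle x hx hxL
    have h2 := norm_add_le (φ x - P (φ x)) (P (φ x) : E)
    rw [sub_add_cancel] at h2
    have h3 : ‖(P (φ x) : E)‖ = ‖P (φ x)‖ := rfl
    linarith
  have : LocallyCompactSpace L := hL.isClosedEmbedding_subtypeVal.locallyCompactSpace
  set V : Set L := Subtype.val ⁻¹' (interior V₀ ∩ U)
  have hVo : IsOpen V := (isOpen_interior.inter h.isOpen).preimage continuous_subtype_val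
  have hV1 : (1 : L) ∈ V := ⟨mem_interior_iff_mem_nhds.2 hV₀, h.one_mem⟩
  have hcont : ContinuousOn (fun x : L => P (φ x)) V :=
    P.continuous.comp_continuousOn (h.continuousOn.comp continuous_subtype_val.continuousOn
      fun x hx => hx.2)
  have hsmall : ∀ S ∈ 𝓝 (1 : L), ∃ ρ > 0, ∀ x ∈ V, ‖P (φ x)‖ < ρ → x ∈ S := by
    intro S hS
    rw [nhds_subtype, mem_comap] at hS
    obtain ⟨S', hS', hSS⟩ := hS
    obtain ⟨ρ, hρ, hsm⟩ := h.mem_of_small S' hS'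
    refine ⟨ρ / 2, by positivity, fun x hx hxs => hSS (hsm x hx.2 ?_)⟩
    have := hle' x (interior_subset hx.1) x.2
    linarith
  have hmul : ∀ ε > 0, ∃ S ∈ 𝓝 (1 : L), ∀ x ∈ S, ∀ z ∈ S,
      ‖P (φ (x * z : L)) - P (φ x) - P (φ z)‖ ≤ ε * ‖P (φ z)‖ := by
    intro ε hε
    set M := ‖P‖ + 1
    have hM : 0 < M := by positivity
    obtain ⟨S, hS, hm⟩ := h.map_mul (ε / (2 * M)) (by positivity)
    refine ⟨Subtype.val ⁻¹' (S ∩ V₀), continuous_subtype_val.continuousAt (by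
      simpa using inter_mem hS hV₀), fun x hx z hz => ?_⟩
    rw [← map_sub, ← map_sub]
    calc ‖P (φ (x * z : G) - φ x - φ z)‖ ≤ M * ‖φ (x * z : G) - φ x - φ z‖ :=
          (P.le_opNorm _).trans (by gcongr; simp [M])
      _ ≤ M * (ε / (2 * M) * (2 * ‖P (φ z)‖)) := by
          gcongr
          refine (hm _ hx.1 _ hz.1).trans ?_
          gcongr
          exact hle' z hz.2 z.2
      _ = ε * ‖P (φ z)‖ := by field_simp
  refine ⟨V, hVo, hV1, by simp [h.map_one], hcont, hsmall, hmul, fun S hS => ?_⟩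
  refine image_mem_nhds_zero hVo hV1 (by simp [h.map_one]) hcont hsmall hmul (fun v => ?_) hS
  obtain ⟨γ, g1, g2, g3⟩ := htan v v.2
  refine ⟨γ, g1, g2, ?_⟩
  have := P.hasFDerivAt.comp_hasDerivAt (0 : ℝ) g3
  rwa [hPl] at this

end ClosedSubgroup

/-! ### The chart at the identity and the adjoint map -/

section LieGroup

variable (E : Type*) [NormedAddCommGroup E] [NormedSpace ℝ E]
  {G : Type*} [Group G] [TopologicalSpace G] [ChartedSpace E G]

/-- The preferred chart at the identity, translated so as to map the identity to `0`. -/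
noncomputable def chartOne (x : G) : E :=
  extChartAt 𝓘(ℝ, E) (1 : G) x - extChartAt 𝓘(ℝ, E) (1 : G) 1

variable {E}

theorem hasMFDerivAt_iff_chartOne {γ : ℝ → G} (h0 : γ 0 = 1) {X : E} :
    HasMFDerivAt 𝓘(ℝ, ℝ) 𝓘(ℝ, E) γ 0
      (ContinuousLinearMap.toSpanSingleton ℝ (X : E) : ℝ →L[ℝ] E) ↔
    ContinuousAt γ 0 ∧ HasDerivAt (fun t => chartOne E (γ t)) X 0 := by
  have e : writtenInExtChartAt 𝓘(ℝ, ℝ) 𝓘(ℝ, E) 0 γ =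
      fun t => extChartAt 𝓘(ℝ, E) (1 : G) (γ t) := by
    ext t
    simp only [writtenInExtChartAt, h0]
    rfl
  have e2 : HasDerivAt (fun t => chartOne E (γ t)) X 0 ↔
      HasDerivAt (fun t => extChartAt 𝓘(ℝ, E) (1 : G) (γ t)) X 0 := hasDerivAt_sub_const_iff _
  rw [e2, hasDerivAt_iff_hasFDerivAt, ← hasFDerivWithinAt_univ, ← e]
  have hr : range 𝓘(ℝ, ℝ) = univ := by simp
  rw [← hr]
  exact Iff.rfl

theorem tendsto_extChartAt_one : Tendsto (extChartAt 𝓘(ℝ, E) (1 : G)) (𝓝 1)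
    (𝓝 (extChartAt 𝓘(ℝ, E) (1 : G) 1)) :=
  continuousAt_extChartAt (I := 𝓘(ℝ, E)) (1 : G)

variable [LieGroup 𝓘(ℝ, E) ∞ G]

theorem isLocalModel_chartOne :
    IsLocalModel (chartOne E : G → E) (extChartAt 𝓘(ℝ, E) (1 : G)).source where
  isOpen := isOpen_extChartAt_source _
  one_mem := mem_extChartAt_source _
  map_one := sub_self _
  continuousOn := (continuousOn_extChartAt _).sub continuousOn_const
  mem_of_small V hV := by
    have hc := continuousAt_extChartAt_symm (I := 𝓘(ℝ, E)) (1 : G)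
    have : (extChartAt 𝓘(ℝ, E) (1 : G)).symm ⁻¹' V ∈ 𝓝 (extChartAt 𝓘(ℝ, E) (1 : G) 1) :=
      hc (by simpa using hV)
    obtain ⟨ρ, hρ, hb⟩ := Metric.mem_nhds_iff.1 this
    refine ⟨ρ, hρ, fun x hx hxs => ?_⟩
    have := hb (show extChartAt 𝓘(ℝ, E) (1 : G) x ∈ _ from mem_ball_iff_norm.2 hxs)
    rwa [mem_preimage, (extChartAt 𝓘(ℝ, E) (1 : G)).left_inv hx] at this
  image_mem V hV := by
    have h1 := map_extChartAt_nhds_of_boundaryless (I := 𝓘(ℝ, E)) (1 : G)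
    have h2 : map (chartOne E : G → E) (𝓝 1) = 𝓝 0 := by
      have : (chartOne E : G → E) = (fun u => u - extChartAt 𝓘(ℝ, E) (1 : G) 1) ∘
          extChartAt 𝓘(ℝ, E) (1 : G) := rfl
      rw [this, ← Filter.map_map, h1]
      simp
    rw [← h2]
    exact image_mem_map hV
  map_mul ε hε := by
    set ψ := extChartAt 𝓘(ℝ, E) (1 : G)
    set e := ψ 1
    have hsymm : ContMDiffAt 𝓘(ℝ, E) 𝓘(ℝ, E) ∞ ψ.symm e :=
      (contMDiffOn_extChartAt_symm (1 : G)).contMDiffAt (extChartAt_target_mem_nhds (1 : G))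
    have hse : ψ.symm e = 1 := extChartAt_to_inv (I := 𝓘(ℝ, E)) (1 : G)
    let F : E × E → E := fun p => ψ (ψ.symm p.1 * ψ.symm p.2)
    have hF : ContDiffAt ℝ ∞ F (e, e) := by
      rw [← contMDiffAt_iff_contDiffAt]
      have h1 : ContMDiffAt 𝓘(ℝ, E × E) 𝓘(ℝ, E) ∞ (fun p : E × E => ψ.symm p.1) (e, e) :=
        ContMDiffAt.comp (e, e) (by exact hsymm) contDiff_fst.contMDiff.contMDiffAt
      have h2 : ContMDiffAt 𝓘(ℝ, E × E) 𝓘(ℝ, E) ∞ (fun p : E × E => ψ.symm p.2) (e, e) :=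
        ContMDiffAt.comp (e, e) (by exact hsymm) contDiff_snd.contMDiff.contMDiffAt
      have h3 := h1.mul h2
      refine ContMDiffAt.comp (e, e) (g := ψ) ?_ h3
      have : ψ.symm (e, e).1 * ψ.symm (e, e).2 = 1 := by simp [hse]
      simp only [this]
      exact contMDiffAt_extChartAt
    -- Strict differentiability allows comparing `(x, z)` with the moving point `(x, 1)`, so the
    -- error is relative to the chart norm of `z` alone, as `map_mul` demands.
    obtain ⟨D, hD⟩ : ∃ D, HasStrictFDerivAt F D (e, e) :=
      ⟨_, hF.hasStrictFDerivAt (by simp)⟩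
    have hDr : ∀ w, D (0, w) = w := by
      have h1 : HasFDerivAt (fun v => F (e, v)) (D.comp (ContinuousLinearMap.inr ℝ E E)) e :=
        HasFDerivAt.comp e hD.hasFDerivAt (hasFDerivAt_prodMk_right e e)
      have h2 : (fun v => F (e, v)) =ᶠ[𝓝 e] id := by
        filter_upwards [extChartAt_target_mem_nhds (I := 𝓘(ℝ, E)) (1 : G)] with v hv
        simp only [F, hse, one_mul]
        exact ψ.right_inv hv
      have h3 := (h1.congr_of_eventuallyEq h2.symm).unique (hasFDerivAt_id e)
      intro w
      exact congrArg (fun T : E →L[ℝ] E => T w) h3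
    have hlo := hD.isLittleO.def hε
    have ht : Tendsto (fun x : G × G => ((ψ x.1, ψ x.2), (ψ x.1, e))) (𝓝 (1, 1))
        (𝓝 ((e, e), (e, e))) := by
      have t1 : Tendsto (fun x : G × G => ψ x.1) (𝓝 (1, 1)) (𝓝 e) :=
        tendsto_extChartAt_one.comp (continuous_fst.tendsto (1, 1))
      have t2 : Tendsto (fun x : G × G => ψ x.2) (𝓝 (1, 1)) (𝓝 e) :=
        tendsto_extChartAt_one.comp (continuous_snd.tendsto (1, 1))
      exact (t1.prodMk_nhds t2).prodMk_nhds (t1.prodMk_nhds tendsto_const_nhds)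
    have hev := ht.eventually hlo
    rw [nhds_prod_eq] at hev
    obtain ⟨S, hS, S', hS', hSS⟩ := mem_prod_iff.1 hev
    have hsrc : ψ.source ∈ 𝓝 (1 : G) := extChartAt_source_mem_nhds (I := 𝓘(ℝ, E)) (1 : G)
    refine ⟨S ∩ S' ∩ ψ.source, inter_mem (inter_mem hS hS') hsrc, fun x hx z hz => ?_⟩
    have key := hSS (mk_mem_prod hx.1.1 hz.1.2)
    simp only [mem_ofPred_eq, F, hse, mul_one, ψ.left_inv hx.2, ψ.left_inv hz.2,
      Prod.mk_sub_mk, sub_self, hDr] at key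
    have en : ‖((0 : E), ψ z - e)‖ = ‖ψ z - e‖ := by simp [Prod.norm_def]
    rw [en] at key
    have e1 : chartOne E (x * z) - chartOne E x - chartOne E z =
        ψ (x * z) - ψ x - (ψ z - e) := by
      simp only [chartOne]; abel
    rw [e1]
    exact key

theorem contMDiff_conj (g : G) :
    ContMDiff 𝓘(ℝ, E) 𝓘(ℝ, E) ∞ (fun x : G => g * x * g⁻¹) :=
  (contMDiff_mul_right (a := g⁻¹)).comp (contMDiff_mul_left (a := g))

/-- The adjoint map as a continuous linear map of the model space. -/
noncomputable def AdCLM (E : Type*) [NormedAddCommGroup E] [NormedSpace ℝ E]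
    {G : Type*} [Group G] [TopologicalSpace G] [ChartedSpace E G] (g : G) : E →L[ℝ] E :=
  mfderiv 𝓘(ℝ, E) 𝓘(ℝ, E) (fun x : G => g * x * g⁻¹) 1

theorem hasFDerivAt_conj_chart (g : G) :
    HasFDerivAt (fun u => extChartAt 𝓘(ℝ, E) (1 : G)
      (g * (extChartAt 𝓘(ℝ, E) (1 : G)).symm u * g⁻¹)) (AdCLM E g)
      (extChartAt 𝓘(ℝ, E) (1 : G) 1) := by
  have hd := ((contMDiff_conj (E := E) g (1 : G)).mdifferentiableAt (by simp)).hasMFDerivAt.2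
  have e : writtenInExtChartAt 𝓘(ℝ, E) 𝓘(ℝ, E) (1 : G) (fun x : G => g * x * g⁻¹) =
      fun u => extChartAt 𝓘(ℝ, E) (1 : G)
        (g * (extChartAt 𝓘(ℝ, E) (1 : G)).symm u * g⁻¹) := by
    ext u
    simp only [writtenInExtChartAt, mul_one, mul_inv_cancel]
    rfl
  rw [e] at hd
  simp only [modelWithCornersSelf_coe, range_id] at hd
  exact hd.hasFDerivAt univ_mem

theorem chartOne_conj_approx (g : G) {ε : ℝ} (hε : 0 < ε) :
    ∃ V ∈ 𝓝 (1 : G), ∀ x ∈ V,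
      ‖chartOne E (g * x * g⁻¹) - AdCLM E g (chartOne E x)‖ ≤ ε * ‖chartOne E x‖ := by
  set ψ := extChartAt 𝓘(ℝ, E) (1 : G)
  have hlo := (hasFDerivAt_iff_isLittleO.1 (hasFDerivAt_conj_chart (E := E) g)).def hε
  have hev := tendsto_extChartAt_one.eventually hlo
  have hsrc : ψ.source ∈ 𝓝 (1 : G) := extChartAt_source_mem_nhds (I := 𝓘(ℝ, E)) (1 : G)
  refine ⟨_, inter_mem hev hsrc, fun x ⟨hx, hxs⟩ => ?_⟩
  have hse : ψ.symm (ψ 1) = 1 := extChartAt_to_inv (I := 𝓘(ℝ, E)) (1 : G)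
  simp only [mem_ofPred_eq] at hx
  rw [ψ.left_inv hxs, hse, mul_one, mul_inv_cancel] at hx
  exact hx

theorem AdCLM_inv_apply (g : G) (X : E) : AdCLM E g⁻¹ (AdCLM E g X) = X := by
  set ψ := extChartAt 𝓘(ℝ, E) (1 : G)
  have hse : ψ.symm (ψ 1) = 1 := extChartAt_to_inv (I := 𝓘(ℝ, E)) (1 : G)
  have h1 := hasFDerivAt_conj_chart (E := E) g
  have h2 := hasFDerivAt_conj_chart (E := E) g⁻¹
  have h3 : HasFDerivAt (fun u => ψ (g⁻¹ * ψ.symm u * g⁻¹⁻¹)) (AdCLM E g⁻¹)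
      (ψ (g * ψ.symm (ψ 1) * g⁻¹)) := by
    rw [hse, mul_one, mul_inv_cancel]; exact h2
  have h4 := h3.comp (ψ 1) h1
  have hsrc : ψ.source ∈ 𝓝 (1 : G) := extChartAt_source_mem_nhds (I := 𝓘(ℝ, E)) (1 : G)
  have hc : Tendsto (fun u => g * ψ.symm u * g⁻¹) (𝓝 (ψ 1)) (𝓝 1) := by
    have hs : Tendsto ψ.symm (𝓝 (ψ 1)) (𝓝 1) := by
      have := continuousAt_extChartAt_symm (I := 𝓘(ℝ, E)) (1 : G)
      rwa [ContinuousAt, extChartAt_to_inv] at this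
    have hg : ContinuousAt (fun x : G => g * x * g⁻¹) 1 :=
      (contMDiff_conj (E := E) g).continuous.continuousAt
    have := hg.tendsto.comp hs
    simpa [Function.comp_def] using this
  have h5 : ((fun u => ψ (g⁻¹ * ψ.symm u * g⁻¹⁻¹)) ∘ fun u => ψ (g * ψ.symm u * g⁻¹))
      =ᶠ[𝓝 (ψ 1)] id := by
    filter_upwards [hc hsrc, extChartAt_target_mem_nhds (I := 𝓘(ℝ, E)) (1 : G)] with u hu hut
    simp only [Function.comp_apply, id]
    rw [ψ.left_inv hu]
    have : g⁻¹ * (g * ψ.symm u * g⁻¹) * g⁻¹⁻¹ = ψ.symm u := by group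
    rw [this]
    exact ψ.right_inv hut
  have h6 := (h4.congr_of_eventuallyEq h5.symm).unique (hasFDerivAt_id (ψ 1))
  exact congrArg (fun T : E →L[ℝ] E => T X) h6

/-- Conjugation by an element of the normalizer of a closed subgroup `L` scales the Haar measure
of `L` by at most the determinant of the adjoint map on the Lie algebra of `L`. -/
theorem mulEquivHaarChar_conjEquiv_le [FiniteDimensional ℝ E] [IsTopologicalGroup G]
    [LocallyCompactSpace G] [T2Space G] [SecondCountableTopology G] {L : Subgroup G}
    (hL : IsClosed (L : Set G)) [LocallyCompactSpace L] [MeasurableSpace L] [BorelSpace L]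
    (g : G) (hg : g ∈ Subgroup.normalizer (L : Set G)) :
    (mulEquivHaarChar (conjEquiv L g hg) : ℝ) ≤ |detAd E L g hg| := by
  let l : Submodule ℝ E := lieAlg (E := E) L
  have hAd : ∀ X ∈ l, AdCLM E g X ∈ l := Ad_mem_lieAlg hg
  have hmodel := isLocalModel_chartOne (E := E) (G := G)
  obtain ⟨P, hP⟩ : l.ClosedComplemented :=
    .of_finiteDimensional_quotient l.closed_of_finiteDimensional
  have hl : ∀ (γ : ℝ → G) (X : E), (∀ s t, γ (s + t) = γ s * γ t) → (∀ t, γ t ∈ L) →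
      ContinuousAt γ 0 → HasDerivAt (fun t => chartOne E (γ t)) X 0 → X ∈ l := by
    intro γ X h1 h2 h3 h4
    have h0 : γ 0 = 1 := by simpa using h1 0 0
    have hX : X ∈ lieAlg (E := E) L :=
      Submodule.subset_span ⟨γ, ⟨h1, (hasMFDerivAt_iff_chartOne h0).2 ⟨h3, h4⟩⟩, h2⟩
    exact hX
  have htan : ∀ v ∈ l, IsTangent (chartOne E) L v := by
    intro v hv
    have hv' : v ∈ Submodule.span ℝ ({X | ∃ γ : ℝ → G, IsOneParam γ X ∧ ∀ t, γ t ∈ L} : Set E) := hv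
    refine hmodel.isTangent_span ?_ hv'
    rintro X ⟨γ, ⟨h1, h2⟩, h3⟩
    have h0 : γ 0 = 1 := by simpa using h1 0 0
    obtain ⟨h4, h5⟩ := (hasMFDerivAt_iff_chartOne h0).1 h2
    refine ⟨fun t => ⟨γ t, h3 t⟩, ?_, Subtype.ext h0, h5⟩
    rw [tendsto_subtype_rng]
    simpa [ContinuousAt, h0] using h4
  obtain ⟨V, hV⟩ := hmodel.subgroup hL l P hP hl htan
  have hcone : ∀ ε > 0, ∃ V ∈ 𝓝 (1 : G), ∀ x ∈ V, x ∈ L →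
      ‖chartOne E x - P (chartOne E x)‖ ≤ ε * ‖chartOne E x‖ :=
    fun ε hε => hmodel.norm_sub_proj_le hL (l.subtypeL.comp P) (fun γ X g1 g2 g3 g4 =>
      congrArg Subtype.val (hP ⟨X, hl γ X g1 g2 g3 g4⟩)) hε
  let A₀ : l →ₗ[ℝ] l := (AdCLM E g : E →ₗ[ℝ] E).restrict hAd
  have hinj : Function.Injective A₀ := by
    intro x y hxy
    have h1 : AdCLM E g x = AdCLM E g y := congrArg Subtype.val hxy
    have h2 := congrArg (AdCLM E g⁻¹) h1
    rw [AdCLM_inv_apply, AdCLM_inv_apply] at h2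
    exact Subtype.ext h2
  let A : l ≃L[ℝ] l := (LinearEquiv.ofInjectiveEndo A₀ hinj).toContinuousLinearEquiv
  have hA : ∀ v : l, (A v : E) = AdCLM E g v := fun v => rfl
  have hdet : LinearMap.det (A : l →ₗ[ℝ] l) = detAd E L g hg := by
    have : (A : l →ₗ[ℝ] l) = A₀ := LinearMap.ext fun v => rfl
    rw [this]
    rfl
  borelize (l : Type _)
  have : SecondCountableTopology L :=
    TopologicalSpace.Subtype.secondCountableTopology (L : Set G)
  have : SigmaCompactSpace L := sigmaCompactSpace_of_locallyCompact_secondCountable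
  have : SFinite (Measure.haar : Measure L) := inferInstance
  rw [← hdet]
  refine hV.mulEquivHaarChar_le Measure.haar (conjEquiv L g hg) A fun ε hε => ?_
  set M := ‖P‖ + 1
  set N := ‖AdCLM E g‖ + 1
  have hM : 0 < M := by positivity
  have hN : 0 < N := by positivity
  obtain ⟨V₁, hV₁, h1⟩ := hcone (1 / 2) (by norm_num)
  obtain ⟨V₂, hV₂, h2⟩ := hcone (ε / (4 * M * N)) (by positivity)
  obtain ⟨V₃, hV₃, h3⟩ := chartOne_conj_approx (E := E) g (ε := ε / (4 * M)) (by positivity)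
  refine ⟨Subtype.val ⁻¹' (V₁ ∩ V₂ ∩ V₃), continuous_subtype_val.continuousAt (by
    simpa using inter_mem (inter_mem hV₁ hV₂) hV₃), fun x ⟨⟨hx1, hx2⟩, hx3⟩ => ?_⟩
  have hle : ‖chartOne E (x : G)‖ ≤ 2 * ‖P (chartOne E (x : G))‖ := by
    have a1 := h1 x hx1 x.2
    have a2 := norm_add_le (chartOne E (x : G) - P (chartOne E (x : G)))
      (P (chartOne E (x : G)) : E)
    rw [sub_add_cancel] at a2
    have a3 : ‖(P (chartOne E (x : G)) : E)‖ = ‖P (chartOne E (x : G))‖ := rfl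
    linarith
  have hPA : A (P (chartOne E (x : G))) = P (AdCLM E g (P (chartOne E (x : G)))) := by
    rw [← hA, hP]
  -- The first term is the first-order error of conjugation in `G`, the second the distance of `x`
  -- from the Lie algebra. Each contributes `ε/4`, and passing from `φ x` to `P (φ x)` doubles the
  -- sum.
  have hsplit : P (chartOne E (conjEquiv L g hg x : G)) - A (P (chartOne E (x : G))) =
      P (chartOne E (g * x * g⁻¹) - AdCLM E g (chartOne E (x : G))) +
      P (AdCLM E g (chartOne E (x : G) - P (chartOne E (x : G)))) := by
    rw [hPA, ← map_sub, ← map_add, map_sub (AdCLM E g), sub_add_sub_cancel]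
    rfl
  have hPle : ∀ v, ‖P v‖ ≤ M * ‖v‖ := fun v => (P.le_opNorm v).trans (by gcongr; simp [M])
  have hNle : ∀ v, ‖AdCLM E g v‖ ≤ N * ‖v‖ := fun v =>
    ((AdCLM E g).le_opNorm v).trans (by gcongr; simp [N])
  rw [hsplit]
  calc _ ≤ _ := norm_add_le _ _
    _ ≤ M * (ε / (4 * M) * ‖chartOne E (x : G)‖) +
        M * (N * (ε / (4 * M * N) * ‖chartOne E (x : G)‖)) := by
        gcongr
        · exact (hPle _).trans (by gcongr; exact h3 x hx3)
        · refine (hPle _).trans ?_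
          gcongr
          exact (hNle _).trans (by gcongr; exact h2 x hx2 x.2)
    _ = ε / 2 * ‖chartOne E (x : G)‖ := by field_simp; ring
    _ ≤ ε / 2 * (2 * ‖P (chartOne E (x : G))‖) := by gcongr
    _ = ε * ‖P (chartOne E (x : G))‖ := by ring

end LieGroup

end EffVar

/-! ### The effective variational principle -/

theorem proposition2p11
    -- a real Lie group with a proper right invariant metric
    {E : Type*} [NormedAddCommGroup E] [NormedSpace ℝ E] [FiniteDimensional ℝ E]
    {G : Type*} [Group G] [MetricSpace G] [ProperSpace G] [IsTopologicalGroup G]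
    [ChartedSpace E G] [LieGroup 𝓘(ℝ, E) ∞ G]
    (hdist : ∀ x y g : G, dist (x * g) (y * g) = dist x y)
    -- a lattice
    (Γ : Subgroup G) [DiscreteTopology Γ]
    -- `𝒜` is a `σ`-algebra on `G ⧸ Γ`, next to the Borel `σ`-algebra `ℬ`, which is the default one
    (𝒜 : MeasurableSpace (G ⧸ Γ)) [ℬ : MeasurableSpace (G ⧸ Γ)] [BorelSpace (G ⧸ Γ)]
    (hΓ : EffVar.HasInvariantProbability Γ)
    (a : G) (ha : EffVar.IsAdDiagonalizable E a)
    -- a closed subgroup of `G⁺` normalized by `a`, with a Haar measure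
    (L : Subgroup G) (hLclosed : IsClosed (L : Set G)) (hLG : (L : Set G) ⊆ EffVar.unstable a)
    (haL : a ∈ Subgroup.normalizer (L : Set G))
    [MeasurableSpace L] [BorelSpace L] (mL : Measure L) [mL.IsHaarMeasure]
    (μ : Measure (G ⧸ Γ)) [IsProbabilityMeasure μ]
    (hμ : MeasurePreserving (fun y : G ⧸ Γ => a • y) μ μ)
    (j : ℕ)
    (h𝒜 : 𝒜 ≤ ℬ)
    (hgen : @MeasurableSpace.CountablyGenerated (G ⧸ Γ) 𝒜)
    (hdesc : EffVar.IsDescending a 𝒜) (hsub : EffVar.IsSubordinate 𝒜 L μ)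
    (K : Set (G ⧸ Γ)) (hK : MeasurableSet[ℬ] K)
    (B : Set L) (hB : MeasurableSet B) (hBsymm : B⁻¹ = B)
    (hKB : ∀ y ∈ K, EffVar.atom 𝒜 y ⊆ (fun b : L => b • y) '' B) :
    (EffVar.condEntropy 𝒜 (EffVar.translate (a ^ j) 𝒜) μ : EReal) ≤
      (Real.log |EffVar.detAd E L (a ^ j) (pow_mem haL j)| : EReal) +
        EffVar.integralLog μ
          (fun y => EffVar.tau (EffVar.translate (a ^ j) 𝒜) L mL y (Kᶜ ∪ B • μ.support)) := by
  have : ProperSpace L := EffVar.properSpace_of_isClosed hLclosed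
  have hmod := EffVar.mulEquivHaarChar_conjEquiv_le (E := E) hLclosed (a ^ j) (pow_mem haL j)
  have hpos : (0 : ℝ) < mulEquivHaarChar (EffVar.conjEquiv L (a ^ j) (pow_mem haL j)) := by
    exact_mod_cast mulEquivHaarChar_pos _
  have hlog := Real.log_le_log hpos hmod
  have hle := (EffVar.condEntropy_add_lintegral_negLog_le mL hLclosed hLG haL hμ j h𝒜 hgen hdesc
    hsub hBsymm hKB).trans (ENNReal.ofReal_le_ofReal hlog)
  -- Nonnegativity of the logarithm makes the truncation in `ENNReal.ofReal` harmless.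
  have hlog0 := (EffVar.lintegral_negLog_tau_atom_le mL hLclosed hLG haL hμ j h𝒜 hgen hdesc
    hsub).1.trans hlog
  rw [EffVar.integralLog, ← sub_eq_add_neg]
  -- The integral may be `-∞`; moved to the left it is a nonnegative summand, and finiteness of the
  -- determinant term justifies the move.
  refine (EReal.le_sub_iff_add_le (Or.inr (EReal.coe_ne_bot _)) (Or.inr (EReal.coe_ne_top _))).2 ?_
  have h := EReal.coe_ennreal_le_coe_ennreal_iff.2 hle
  rw [EReal.coe_ennreal_add, EReal.coe_ennreal_ofReal, max_eq_left hlog0] at h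
  exact h
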